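/- Let $H$ be a real Hilbert space and $\Phi:H\to\mathbb{R}\cup\{\pm\infty\}$ proper, convex and lower semicontinuous with $\operatorname{argmin}\Phi\neq\emptyset$; let $x^*$ be the element of minimal norm of $\operatorname{argmin}\Phi$. For $\lambda>0$ let $\Phi_\lambda(x)=\inf_{y\in H}\{\Phi(y)+\frac{1}{2\lambda}\|x-y\|^2\}$ be the Moreau envelope, and for $\varepsilon,\lambda>0$ let $\varphi_{\varepsilon,\lambda}(x)=\Phi_\lambda(x)+\frac{\varepsilon}{2}\|x\|^2$, with unique minimizer $x_{\varepsilon,\lambda}$. Let $\alpha,\beta,t_0>0$, let $\lambda:[t_0,\infty)\to(0,\infty)$ be continuously differentiable and nondecreasing, and let $\varepsilon:[t_0,\infty)\to(0,\infty)$ be continuously differentiable and nonincreasing with $\varepsilon(t)\to0$ as $t\to\infty$. Let $x:[t_0,\infty)\to H$ be a strong solution of $$\ddot x(t)+\alpha\sqrt{\varepsilon(t)}\,\dot x(t)+\beta\frac{d}{dt}\big(\nabla\Phi_{\lambda(t)}(x(t))\big)+\nabla\Phi_{\lambda(t)}(x(t))+\varepsilon(t)x(t)=0,$$ that is, $x$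 is differentiable, $\dot x$ is locally absolutely continuous, and the equation holds for almost every $t\ge t_0$. Assume that $\lambda(t)\varepsilon(t)\to0$ as $t\to\infty$, that $\frac{\alpha}{2}\le\gamma<\alpha$, and that $a,c>0$ are such that for all sufficiently large $t$ $$\frac{d}{dt}\Big(\frac1{\sqrt{\varepsilon(t)}}\Big)\le\min\Big\{2\gamma-\alpha-\frac{\gamma\beta\dot\varepsilon(t)}{2\varepsilon(t)},\ \alpha-\gamma\frac{a+1}{a}\Big\},$$ $$\Big(2\gamma(\alpha-\gamma)+\frac{\gamma}{c}-1\Big)\varepsilon(t)-\beta\dot\varepsilon(t)\le0,$$ $$2\beta\varepsilon^2(t)+\big(2-\gamma\beta\sqrt{\varepsilon(t)}\big)\dot\varepsilon(t)\le0,$$ $$\Big(\frac{\gamma}{a}+2(\alpha-\gamma)\Big)\beta^2\sqrt{\varepsilon(t)}-\frac{3\beta^2\dot\varepsilon(t)}{2\varepsilon(t)}-\dot\lambda(t)\le\beta.$$ Put $$E(t)=\varphi_{\varepsilon(t),\lambda(t)}(x(t))-\varphi_{\varepsilon(t),\lambda(t)}(x_{\varepsilon(t),\lambda(t)})+\frac12\big\|\gamma\sqrt{\varepsilon(t)}\,(x(t)-x_{\varepsilon(t),\lambda(t)})+\dot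 x(t)+\beta\nabla\Phi_{\lambda(t)}(x(t))\big\|^2,$$ $$\mu(t)=(\alpha-\gamma)\sqrt{\varepsilon(t)}-\frac{\dot\varepsilon(t)}{2\varepsilon(t)},$$ $$g(t)=\dot\lambda(t)\varepsilon^2(t)-\dot\varepsilon(t)+\frac{\gamma\beta\dot\varepsilon(t)\sqrt{\varepsilon(t)}}{2}+\gamma(2a+c\gamma)\sqrt{\varepsilon(t)}\Big(\frac{2\dot\lambda(t)}{\lambda(t)}-\frac{\dot\varepsilon(t)}{\varepsilon(t)}\Big)^2 .$$ Then there exists $t_1\ge t_0$ such that, with $\Gamma(t)=\exp\big(\int_{t_1}^t\mu(s)\,ds\big)$, the following hold. 1. $E$ is locally absolutely continuous on $[t_1,\infty)$, and for almost every $t\ge t_1$ it is differentiable at $t$ with $$\dot E(t)+\mu(t)E(t)+\frac{\beta}{2}\|\nabla\varphi_{\varepsilon(t),\lambda(t)}(x(t))\|^2\le\frac{g(t)\|x^*\|^2}{2}.$$ 2. For all $t\ge t_1$, $$\beta\int_{t_1}^t\|\nabla\varphi_{\varepsilon(s),\lambda(s)}(x(s))\|^2\,ds\le2E(t_1)+\|x^*\|^2\int_{t_1}^tg(s)\,ds$$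 (the integral on the left being of an integrable function). 3. For all $t\ge t_1$, $$E(t)\le\frac{\|x^*\|^2}{2\Gamma(t)}\int_{t_1}^t\Gamma(s)g(s)\,ds+\frac{\Gamma(t_1)E(t_1)}{\Gamma(t)}.$$ -/

import Mathlib

open Set Filter Topology MeasureTheory

noncomputable section

namespace TikhonovMoreau

variable {H : Type*} [NormedAddCommGroup H] [InnerProductSpace ℝ H] [CompleteSpace H]

/-- A proper, convex and lower semicontinuous extended-real-valued function. -/
structure IsProperConvexLsc (Φ : H → EReal) : Prop where
  ne_bot : ∀ x, Φ x ≠ ⊥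
  exists_ne_top : ∃ x, Φ x ≠ ⊤
  convex : ∀ x y : H, ∀ a b : ℝ, 0 < a → 0 < b → a + b = 1 →
    Φ (a • x + b • y) ≤ (a : EReal) * Φ x + (b : EReal) * Φ y
  lsc : LowerSemicontinuous Φ

/-- The set of global minimizers of `Φ`. -/
def argminSet (Φ : H → EReal) : Set H := {z | ∀ y, Φ z ≤ Φ y}

/-- A minimizer of the real-valued function `f` over the set `S` (an arbitrary point of `H` if
there is none). -/
def argminOn (f : H → ℝ) (S : Set H) : H :=
  Classical.epsilon fun z => z ∈ S ∧ IsMinOn f S z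

/-- The projection of `0` onto the set of minimizers of `Φ`, i.e. the minimizer of least norm. -/
def minNormSol (Φ : H → EReal) : H := argminOn (fun z => ‖z‖) (argminSet Φ)

/-- The Moreau envelope `Φ_l (x) = inf_y { Φ y + ‖x - y‖² / (2 l) }` of index `l`. -/
def moreau (Φ : H → EReal) (l : ℝ) (x : H) : ℝ :=
  (⨅ y : H, Φ y + ((1 / (2 * l) * ‖x - y‖ ^ 2 : ℝ) : EReal)).toReal

/-- The regularized function `φ_{e,l} (x) = Φ_l (x) + e ‖x‖² / 2`. -/
def phi (Φ : H → EReal) (e l : ℝ) (x : H) : ℝ := moreau Φ l x + e * ‖x‖ ^ 2 / 2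

/-- The minimizer `x_{e,l}` of `φ_{e,l}` over the whole space. -/
def regMin (Φ : H → EReal) (e l : ℝ) : H := argminOn (phi Φ e l) univ

/-- Derivative of a function on the half-line `[t₀, ∞)` (one-sided at `t₀`). -/
def dt {F : Type*} [NormedAddCommGroup F] [NormedSpace ℝ F] (t₀ : ℝ) (f : ℝ → F) (t : ℝ) : F :=
  derivWithin f (Ici t₀) t

/-- Strong solutions on `[t₀, ∞)` of
`x'' + α √ε x' + β (d/dt) ∇Φ_{lam(t)}(x(t)) + ∇Φ_{lam(t)}(x) + ε x = 0`:
`x` is differentiable, `x'` is locally absolutely continuous, and the equation, including the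
existence of both derivatives occurring in it, holds at almost every time. -/
structure IsSolution (Φ : H → EReal) (α β t₀ : ℝ) (lam eps : ℝ → ℝ) (x : ℝ → H) : Prop where
  differentiable : DifferentiableOn ℝ x (Ici t₀)
  velocity_ac : ∀ T, t₀ ≤ T → AbsolutelyContinuousOnInterval (dt t₀ x) t₀ T
  equation : ∀ᵐ t, t₀ < t → ∃ x'' w : H,
    HasDerivAt (dt t₀ x) x'' t ∧
    HasDerivAt (fun s => gradient (moreau Φ (lam s)) (x s)) w t ∧
    x'' + (α * √(eps t)) • dt t₀ x t + β • w
      + gradient (moreau Φ (lam t)) (x t) + eps t • x t = 0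

/-- The energy function along `x`. -/
def energy (Φ : H → EReal) (β γ t₀ : ℝ) (lam eps : ℝ → ℝ) (x : ℝ → H) (t : ℝ) : ℝ :=
  phi Φ (eps t) (lam t) (x t) - phi Φ (eps t) (lam t) (regMin Φ (eps t) (lam t))
    + 1 / 2 * ‖(γ * √(eps t)) • (x t - regMin Φ (eps t) (lam t)) + dt t₀ x t
        + β • gradient (moreau Φ (lam t)) (x t)‖ ^ 2

/-- The rate `μ(t) = (α - γ) √ε - ε' / (2 ε)`. -/
def mu (α γ t₀ : ℝ) (eps : ℝ → ℝ) (t : ℝ) : ℝ :=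
  (α - γ) * √(eps t) - dt t₀ eps t / (2 * eps t)

/-- The weight `Γ(t) = exp (∫_{t₁}^t μ)`. -/
def Gam (α γ t₀ : ℝ) (eps : ℝ → ℝ) (t₁ t : ℝ) : ℝ :=
  Real.exp (∫ s in t₁..t, mu α γ t₀ eps s)

/-- The function `g` on the right-hand side of the energy estimates. -/
def gfun (β γ a c t₀ : ℝ) (lam eps : ℝ → ℝ) (t : ℝ) : ℝ :=
  dt t₀ lam t * eps t ^ 2 - dt t₀ eps t + γ * β * dt t₀ eps t * √(eps t) / 2
    + γ * (2 * a + c * γ) * √(eps t)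
      * (2 * dt t₀ lam t / lam t - dt t₀ eps t / eps t) ^ 2

end TikhonovMoreau

end


/-!
Since Moreau envelopes form a semigroup, the minimal value of `φ_{ε,λ}` is `Φ_{λ + 1/ε} (0)`. The
envelope is jointly `C¹` in the index and the point, so the potential part of the energy is `C¹` in
time although nothing is known about the differentiability of the minimizers `x_{ε,λ}`.

The minimizers themselves are only compared at two different times. Monotonicity of the
subdifferential places their difference in a ball whose diameter is a segment on the line spanned by
one of them, which bounds the upper right speed of `t ↦ x_{ε(t),λ(t)}` by
`(2 λ' / λ - ε' / ε) ‖x_{ε(t),λ(t)}‖`. This one-sided bound is enough to estimate the derivative of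
the energy wherever it exists, that is almost everywhere. Strong convexity
of `φ_{ε,λ}`, the conditions on the parameters and Young's inequality absorb the terms that do not
involve `‖x_{ε,λ}‖`, and `‖x_{ε,λ}‖ ≤ ‖x*‖`. The two integral estimates follow by dropping `μ E ≥ 0`
and by multiplying by the integrating factor `Γ`.
-/

noncomputable section

namespace TikhonovMoreau

open scoped InnerProductSpace

section StrongConvexity

variable {E : Type*} [NormedAddCommGroup E] {s : Set E} {m : ℝ} {f : E → ℝ}

lemma exists_pos_forall_sub_one_lt (hclosed : IsClosed {p : E × ℝ | p.1 ∈ s ∧ f p.1 ≤ p.2})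
    (p : E) : ∃ r > 0, ∀ w ∈ s, ‖w - p‖ < r → f p - 1 < f w := by
  have hnotMem : (p, f p - 1) ∉ {p : E × ℝ | p.1 ∈ s ∧ f p.1 ≤ p.2} := fun h => by
    linarith [h.2]
  have hnear : ∀ᶠ w in 𝓝 p, (w, f p - 1) ∉ {p : E × ℝ | p.1 ∈ s ∧ f p.1 ≤ p.2} :=
    (Continuous.prodMk_left (f p - 1)).continuousAt.eventually
      (hclosed.isOpen_compl.mem_nhds hnotMem)
  obtain ⟨r, hr, hball⟩ := Metric.eventually_nhds_iff.1 hnear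
  refine ⟨r, hr, fun w hw hwp => not_le.1 fun hle => hball ?_ ⟨hw, hle⟩⟩
  rwa [dist_eq_norm]

variable [NormedSpace ℝ E]

lemma add_mul_norm_sq_le_of_isMinOn (hf : StrongConvexOn s m f) {p z : E} (hp : p ∈ s)
    (hmin : IsMinOn f s p) (hz : z ∈ s) : f p + m / 2 * ‖z - p‖ ^ 2 ≤ f z := by
  have hsegment : ∀ τ ∈ Ioo (0 : ℝ) 1, f p + (1 - τ) * (m / 2 * ‖z - p‖ ^ 2) ≤ f z := by
    rintro τ ⟨hτ0, hτ1⟩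
    have hsum : τ + (1 - τ) = 1 := add_sub_cancel _ _
    have hconv := hf.2 hz hp hτ0.le (sub_pos.2 hτ1).le hsum
    have hle : f p ≤ f (τ • z + (1 - τ) • p) :=
      hmin (hf.1 hz hp hτ0.le (sub_pos.2 hτ1).le hsum)
    simp only [smul_eq_mul] at hconv
    refine le_of_mul_le_mul_left ?_ hτ0
    linarith
  have hlim : Tendsto (fun τ : ℝ => f p + (1 - τ) * (m / 2 * ‖z - p‖ ^ 2)) (𝓝[>] 0)
      (𝓝 (f p + (1 - 0) * (m / 2 * ‖z - p‖ ^ 2))) :=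
    (Continuous.tendsto (by fun_prop) 0).mono_left nhdsWithin_le_nhds
  rw [sub_zero, one_mul] at hlim
  refine le_of_tendsto hlim ?_
  filter_upwards [Ioo_mem_nhdsGT (zero_lt_one' ℝ)] with τ hτ using hsegment τ hτ

lemma bddBelow_image_of_strongConvexOn (hm : 0 < m) (hf : StrongConvexOn s m f)
    (hclosed : IsClosed {p : E × ℝ | p.1 ∈ s ∧ f p.1 ≤ p.2}) : BddBelow (f '' s) := by
  rcases s.eq_empty_or_nonempty with rfl | ⟨p, hp⟩
  · simp
  obtain ⟨r, hr, hball⟩ := exists_pos_forall_sub_one_lt hclosed p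
  refine ⟨f p - 2 - 1 / (m * r ^ 2), ?_⟩
  rintro _ ⟨z, hz, rfl⟩
  -- `τ` is chosen so that `τ • z + (1 - τ) • p` lies in the ball around `p` where `f > f p - 1`;
  -- strong convexity along `[p, z]` then carries this lower bound over to `z`.
  set d := ‖z - p‖ with hd
  have hd0 : 0 ≤ d := norm_nonneg _
  set τ := r / (2 * r + d) with hτ
  have hτ0 : 0 < τ := by positivity
  have hτ1 : τ ≤ 1 / 2 := by rw [hτ, div_le_iff₀ (by positivity)]; linarith
  have hsum : τ + (1 - τ) = 1 := add_sub_cancel _ _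
  have hwp : ‖τ • z + (1 - τ) • p - p‖ < r := by
    rw [show τ • z + (1 - τ) • p - p = τ • (z - p) by module, norm_smul,
      Real.norm_of_nonneg hτ0.le, ← hd, hτ, div_mul_eq_mul_div, div_lt_iff₀ (by positivity)]
    nlinarith
  have hlow := hball _ (hf.1 hz hp hτ0.le (by linarith) hsum) hwp
  have hconv := hf.2 hz hp hτ0.le (by linarith) hsum
  simp only [smul_eq_mul, ← hd] at hconv
  have hdiff : -(2 + d / r) < f z - f p - (1 - τ) * (m / 2 * d ^ 2) := by
    have hinv : τ * (2 + d / r) = 1 := by rw [hτ]; field_simp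
    refine lt_of_mul_lt_mul_left ?_ hτ0.le
    linarith
  have hquad : d / r ≤ m / 4 * d ^ 2 + 1 / (m * r ^ 2) := by
    have hsq : m / 4 * d ^ 2 + 1 / (m * r ^ 2) - d / r = (m * r * d - 2) ^ 2 / (4 * m * r ^ 2) := by
      field_simp; ring
    have : 0 ≤ (m * r * d - 2) ^ 2 / (4 * m * r ^ 2) := by positivity
    linarith
  have hhalf : 1 / 2 * (m / 2 * d ^ 2) ≤ (1 - τ) * (m / 2 * d ^ 2) := by gcongr; linarith
  linarith

lemma norm_sub_sq_le_of_strongConvexOn (hm : 0 < m) (hf : StrongConvexOn s m f) {b δ : ℝ}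
    (hb : ∀ z ∈ s, b ≤ f z) {y z : E} (hy : y ∈ s) (hz : z ∈ s) (hfy : f y ≤ b + δ)
    (hfz : f z ≤ b + δ) : ‖y - z‖ ^ 2 ≤ 8 / m * δ := by
  have hhalf : (0 : ℝ) ≤ 1 / 2 := by norm_num
  have hsum : (1 / 2 : ℝ) + 1 / 2 = 1 := by norm_num
  have hlow := hb _ (hf.1 hy hz hhalf hhalf hsum)
  have hmid := hf.2 hy hz hhalf hhalf hsum
  simp only [smul_eq_mul] at hmid
  have hscaled : m / 8 * ‖y - z‖ ^ 2 ≤ δ := by linarith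
  rw [div_mul_eq_mul_div, le_div_iff₀ hm]
  linarith only [hscaled]

lemma exists_isMinOn_of_strongConvexOn [CompleteSpace E] (hm : 0 < m)
    (hf : StrongConvexOn s m f) (hs : s.Nonempty)
    (hclosed : IsClosed {p : E × ℝ | p.1 ∈ s ∧ f p.1 ≤ p.2}) : ∃ p ∈ s, IsMinOn f s p := by
  have hbdd := bddBelow_image_of_strongConvexOn hm hf hclosed
  set b := sInf (f '' s)
  have hb : ∀ z ∈ s, b ≤ f z := fun z hz => csInf_le hbdd (mem_image_of_mem f hz)
  have hmin : ∀ n : ℕ, ∃ z ∈ s, f z ≤ b + 1 / ((n : ℝ) + 1) := fun n => by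
    obtain ⟨_, ⟨z, hz, rfl⟩, hlt⟩ :=
      Real.lt_sInf_add_pos (hs.image f) (Nat.one_div_pos_of_nat (n := n))
    exact ⟨z, hz, hlt.le⟩
  choose u hu hfu using hmin
  have hzero : Tendsto (fun n : ℕ => 1 / ((n : ℝ) + 1)) atTop (𝓝 0) :=
    tendsto_one_div_add_atTop_nhds_zero_nat
  have hcauchy : CauchySeq u := by
    refine cauchySeq_of_le_tendsto_0 (fun n : ℕ => √(8 / m * (1 / ((n : ℝ) + 1))))
      (fun j k n hj hk => ?_) (by simpa using (hzero.const_mul (8 / m)).sqrt)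
    rw [dist_eq_norm]
    refine Real.le_sqrt_of_sq_le (norm_sub_sq_le_of_strongConvexOn hm hf hb (hu j) (hu k) ?_ ?_)
    · exact (hfu j).trans (by gcongr)
    · exact (hfu k).trans (by gcongr)
  obtain ⟨p, hp⟩ := cauchySeq_tendsto_of_complete hcauchy
  have hlim : Tendsto (fun n : ℕ => (u n, b + 1 / ((n : ℝ) + 1))) atTop (𝓝 (p, b)) := by
    simpa using hp.prodMk_nhds (hzero.const_add b)
  obtain ⟨hps, hfp⟩ := hclosed.mem_of_tendsto hlim (Eventually.of_forall fun n => ⟨hu n, hfu n⟩)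
  exact ⟨p, hps, fun z hz => hfp.trans (hb z hz)⟩

end StrongConvexity

section Prox

variable {H : Type*} [NormedAddCommGroup H] [InnerProductSpace ℝ H] {Φ : H → EReal}

lemma IsProperConvexLsc.coe_toReal (hΦ : IsProperConvexLsc Φ) {x : H} (hx : Φ x ≠ ⊤) :
    ((Φ x).toReal : EReal) = Φ x :=
  EReal.coe_toReal hx (hΦ.ne_bot x)

lemma IsProperConvexLsc.le_coe_iff (hΦ : IsProperConvexLsc Φ) {x : H} {r : ℝ} :
    Φ x ≤ r ↔ Φ x ≠ ⊤ ∧ (Φ x).toReal ≤ r := by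
  refine ⟨fun h => ?_, fun ⟨hx, h⟩ => ?_⟩
  · have hx : Φ x ≠ ⊤ := ne_top_of_le_ne_top (EReal.coe_ne_top r) h
    rw [← hΦ.coe_toReal hx] at h
    exact ⟨hx, EReal.coe_le_coe_iff.1 h⟩
  · rw [← hΦ.coe_toReal hx]
    exact EReal.coe_le_coe_iff.2 h

lemma IsProperConvexLsc.convexOn_toReal (hΦ : IsProperConvexLsc Φ) :
    ConvexOn ℝ {z | Φ z ≠ ⊤} fun z => (Φ z).toReal := by
  have hcomb : ∀ ⦃x⦄, Φ x ≠ ⊤ → ∀ ⦃y⦄, Φ y ≠ ⊤ → ∀ ⦃a b : ℝ⦄, 0 < a → 0 < b → a + b = 1 →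
      Φ (a • x + b • y) ≠ ⊤ ∧
        (Φ (a • x + b • y)).toReal ≤ a • (Φ x).toReal + b • (Φ y).toReal := by
    intro x hx y hy a b ha hb hab
    have h := hΦ.convex x y a b ha hb hab
    rw [← hΦ.coe_toReal hx, ← hΦ.coe_toReal hy] at h
    exact hΦ.le_coe_iff.1 (by exact_mod_cast h)
  exact convexOn_iff_forall_pos.2
    ⟨convex_iff_forall_pos.2 fun x hx y hy a b ha hb hab => (hcomb hx hy ha hb hab).1,
      fun x hx y hy a b ha hb hab => (hcomb hx hy ha hb hab).2⟩

lemma IsProperConvexLsc.strongConvexOn_add_norm_sub_sq (hΦ : IsProperConvexLsc Φ) (l : ℝ)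
    (x : H) : StrongConvexOn {z | Φ z ≠ ⊤} (1 / l)
      fun z => (Φ z).toReal + 1 / (2 * l) * ‖x - z‖ ^ 2 := by
  rw [strongConvexOn_iff_convex]
  have haffine : ConvexOn ℝ {z | Φ z ≠ ⊤}
      fun z => innerSL ℝ (-(1 / l) • x) z + 1 / (2 * l) * ‖x‖ ^ 2 :=
    ((innerSL ℝ (-(1 / l) • x)).toLinearMap.convexOn hΦ.convexOn_toReal.1).add_const _
  refine (hΦ.convexOn_toReal.add haffine).congr fun z _ => ?_
  simp only [Pi.add_apply, innerSL_apply_apply, real_inner_smul_left, norm_sub_sq_real]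
  ring

lemma IsProperConvexLsc.isClosed_epigraph_add (hΦ : IsProperConvexLsc Φ) {f : H → ℝ}
    (hf : Continuous f) :
    IsClosed {p : H × ℝ | Φ p.1 ≠ ⊤ ∧ (Φ p.1).toReal + f p.1 ≤ p.2} := by
  have hcont : Continuous fun p : H × ℝ => (p.1, ((p.2 - f p.1 : ℝ) : EReal)) :=
    continuous_fst.prodMk (continuous_coe_real_ereal.comp (by fun_prop))
  convert hΦ.lsc.isClosed_epigraph.preimage hcont using 1
  ext p
  simp only [mem_preimage, mem_ofPred_eq, hΦ.le_coe_iff, le_sub_iff_add_le]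

/-- `q` is a subgradient of `Φ` at the point `p` of its domain. The inequality is only required on
the domain, where passing to `EReal.toReal` loses nothing. -/
def IsSubgrad (Φ : H → EReal) (p q : H) : Prop :=
  Φ p ≠ ⊤ ∧ ∀ z, Φ z ≠ ⊤ → (Φ p).toReal + ⟪q, z - p⟫_ℝ ≤ (Φ z).toReal

lemma IsProperConvexLsc.isSubgrad_of_isMinOn (hΦ : IsProperConvexLsc Φ) {l : ℝ} {x p : H}
    (hp : Φ p ≠ ⊤)
    (hmin : IsMinOn (fun z => (Φ z).toReal + 1 / (2 * l) * ‖x - z‖ ^ 2) {z | Φ z ≠ ⊤} p) :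
    IsSubgrad Φ p ((1 / l) • (x - p)) := by
  refine ⟨hp, fun z hz => ?_⟩
  have hquad := add_mul_norm_sq_le_of_isMinOn (hΦ.strongConvexOn_add_norm_sub_sq l x) hp hmin hz
  rw [show x - z = (x - p) - (z - p) by abel,
    norm_sub_sq_real (x - p)] at hquad
  rw [real_inner_smul_left]
  ring_nf at hquad ⊢
  linarith

lemma IsProperConvexLsc.exists_isSubgrad [CompleteSpace H] (hΦ : IsProperConvexLsc Φ) {l : ℝ}
    (hl : 0 < l) (x : H) : ∃ q, IsSubgrad Φ (x - l • q) q := by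
  obtain ⟨p, hp, hmin⟩ := exists_isMinOn_of_strongConvexOn (one_div_pos.2 hl)
    (hΦ.strongConvexOn_add_norm_sub_sq l x) hΦ.exists_ne_top
    (hΦ.isClosed_epigraph_add (f := fun z => 1 / (2 * l) * ‖x - z‖ ^ 2) (by fun_prop))
  refine ⟨(1 / l) • (x - p), ?_⟩
  rw [smul_smul, mul_one_div_cancel hl.ne', one_smul, sub_sub_cancel]
  exact hΦ.isSubgrad_of_isMinOn hp hmin

/-- The Yosida approximation of index `l` of the subdifferential of `Φ`, characterized by
`yosida Φ l x ∈ ∂Φ (x - l • yosida Φ l x)`; the point `x - l • yosida Φ l x` is the proximal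
point of `x`. -/
def yosida (Φ : H → EReal) (l : ℝ) (x : H) : H :=
  Classical.epsilon fun q => IsSubgrad Φ (x - l • q) q

lemma IsProperConvexLsc.isSubgrad_yosida [CompleteSpace H] (hΦ : IsProperConvexLsc Φ) {l : ℝ}
    (hl : 0 < l) (x : H) : IsSubgrad Φ (x - l • yosida Φ l x) (yosida Φ l x) :=
  Classical.epsilon_spec (hΦ.exists_isSubgrad hl x)

lemma IsSubgrad.moreau_eq (hΦ : IsProperConvexLsc Φ) {l : ℝ} (hl : 0 < l) {x q : H}
    (h : IsSubgrad Φ (x - l • q) q) :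
    moreau Φ l x = (Φ (x - l • q)).toReal + l / 2 * ‖q‖ ^ 2 := by
  obtain ⟨hp, hsub⟩ := h
  set p := x - l • q with hp_def
  suffices hinf : (⨅ y : H, Φ y + ((1 / (2 * l) * ‖x - y‖ ^ 2 : ℝ) : EReal)) =
      (((Φ p).toReal + l / 2 * ‖q‖ ^ 2 : ℝ) : EReal) by rw [moreau, hinf, EReal.toReal_coe]
  apply le_antisymm
  · refine (iInf_le _ p).trans (le_of_eq ?_)
    rw [EReal.coe_add, hΦ.coe_toReal hp, hp_def, sub_sub_cancel, norm_smul,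
      Real.norm_of_nonneg hl.le]
    congr 2
    field_simp
  · refine le_iInf fun z => ?_
    by_cases hz : Φ z = ⊤
    · rw [hz, EReal.top_add_coe]; exact le_top
    rw [← hΦ.coe_toReal hz, ← EReal.coe_add, EReal.coe_le_coe_iff]
    have hexpand : 1 / (2 * l) * ‖x - z‖ ^ 2 =
        l / 2 * ‖q‖ ^ 2 - ⟪q, z - p⟫_ℝ + 1 / (2 * l) * ‖z - p‖ ^ 2 := by
      rw [show x - z = l • q - (z - p) by rw [hp_def]; module, norm_sub_sq_real,
        real_inner_smul_left, norm_smul, Real.norm_of_nonneg hl.le]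
      field_simp
    have hnonneg : 0 ≤ 1 / (2 * l) * ‖z - p‖ ^ 2 := by positivity
    linarith [hsub z hz]

lemma IsSubgrad.moreau_ge (hΦ : IsProperConvexLsc Φ) {l l' : ℝ} (hl : 0 < l) (hl' : 0 < l')
    {x x' q q' : H} (h : IsSubgrad Φ (x - l • q) q) (h' : IsSubgrad Φ (x' - l' • q') q') :
    moreau Φ l x + ⟪q, x' - x⟫_ℝ - (l' - l) / 2 * ‖q‖ ^ 2 + l' / 2 * ‖q' - q‖ ^ 2 ≤
      moreau Φ l' x' := by
  rw [h.moreau_eq hΦ hl, h'.moreau_eq hΦ hl']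
  have hsub := h.2 _ h'.1
  rw [show x' - l' • q' - (x - l • q) = (x' - x) - l' • q' + l • q by module, inner_add_right,
    inner_sub_right, real_inner_smul_right, real_inner_smul_right,
    real_inner_self_eq_norm_sq] at hsub
  rw [norm_sub_sq_real, real_inner_comm q q']
  linarith

lemma IsSubgrad.monotone {p q p' q' : H} (h : IsSubgrad Φ p q) (h' : IsSubgrad Φ p' q') :
    0 ≤ ⟪q' - q, p' - p⟫_ℝ := by
  have hle := h.2 _ h'.1
  have hle' := h'.2 _ h.1
  rw [← neg_sub, inner_neg_right] at hle'
  rw [inner_sub_left]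
  linarith

lemma IsSubgrad.mul_norm_sub_le {l l' : ℝ} {x x' q q' : H} (h : IsSubgrad Φ (x - l • q) q)
    (h' : IsSubgrad Φ (x' - l' • q') q') :
    l' * ‖q' - q‖ ≤ ‖x' - x‖ + |l' - l| * ‖q‖ := by
  have hmono := h.monotone h'
  rw [show x' - l' • q' - (x - l • q) = (x' - x) - l' • (q' - q) - (l' - l) • q by module,
    inner_sub_right, inner_sub_right, real_inner_smul_right, real_inner_smul_right,
    real_inner_self_eq_norm_sq] at hmono
  rcases (norm_nonneg (q' - q)).eq_or_lt with hzero | hpos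
  · rw [← hzero, mul_zero]; positivity
  refine le_of_mul_le_mul_right ?_ hpos
  have hpoint := real_inner_le_norm (q' - q) (x' - x)
  have hindex : -((l' - l) * ⟪q' - q, q⟫_ℝ) ≤ |l' - l| * (‖q' - q‖ * ‖q‖) := by
    refine (neg_le_abs _).trans ?_
    rw [abs_mul]
    gcongr
    exact abs_real_inner_le_norm _ _
  linarith

lemma IsSubgrad.eq_of_eq {l : ℝ} (hl : 0 < l) {x q q' : H} (h : IsSubgrad Φ (x - l • q) q)
    (h' : IsSubgrad Φ (x - l • q') q') : q' = q := by
  have hle := h.mul_norm_sub_le h'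
  simp only [sub_self, norm_zero, abs_zero, zero_mul, add_zero] at hle
  exact sub_eq_zero.1 (norm_le_zero_iff.1 (nonpos_of_mul_nonpos_right hle hl))

end Prox

section Moreau

variable {H : Type*} [NormedAddCommGroup H] [InnerProductSpace ℝ H] [CompleteSpace H]
  {Φ : H → EReal} {l : ℝ}

lemma IsProperConvexLsc.yosida_eq (hΦ : IsProperConvexLsc Φ) (hl : 0 < l) {x q : H}
    (h : IsSubgrad Φ (x - l • q) q) : yosida Φ l x = q :=
  h.eq_of_eq hl (hΦ.isSubgrad_yosida hl x)

lemma IsProperConvexLsc.continuousAt_yosida (hΦ : IsProperConvexLsc Φ) (hl : 0 < l) (x : H) :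
    ContinuousAt (fun p : ℝ × H => yosida Φ p.1 p.2) (l, x) := by
  rw [ContinuousAt, tendsto_iff_norm_sub_tendsto_zero]
  have hbound : ContinuousAt (fun p : ℝ × H =>
      (‖p.2 - x‖ + |p.1 - l| * ‖yosida Φ l x‖) / p.1) (l, x) :=
    ContinuousAt.div (by fun_prop) (by fun_prop) hl.ne'
  have hlim := hbound.tendsto
  simp only [sub_self, norm_zero, abs_zero, zero_mul, add_zero, zero_div] at hlim
  refine squeeze_zero' (Eventually.of_forall fun _ => norm_nonneg _) ?_ hlim
  filter_upwards [continuousAt_fst.eventually (lt_mem_nhds hl)] with p hp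
  rw [le_div_iff₀ hp, mul_comm]
  exact (hΦ.isSubgrad_yosida hl x).mul_norm_sub_le (hΦ.isSubgrad_yosida hp p.2)

lemma IsProperConvexLsc.moreau_add_le (hΦ : IsProperConvexLsc Φ) {l' : ℝ} (hl : 0 < l)
    (hl' : 0 < l') (x x' : H) :
    moreau Φ l x + ⟪yosida Φ l x, x' - x⟫_ℝ - (l' - l) / 2 * ‖yosida Φ l x‖ ^ 2 ≤
      moreau Φ l' x' := by
  have h := (hΦ.isSubgrad_yosida hl x).moreau_ge hΦ hl hl' (hΦ.isSubgrad_yosida hl' x')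
  have hnonneg : 0 ≤ l' / 2 * ‖yosida Φ l' x' - yosida Φ l x‖ ^ 2 := by positivity
  linarith

lemma IsProperConvexLsc.abs_moreau_sub_sub_le (hΦ : IsProperConvexLsc Φ) {l' : ℝ} (hl : 0 < l)
    (hl' : 0 < l') (x x' : H) :
    |moreau Φ l' x' - moreau Φ l x
        - (⟪yosida Φ l x, x' - x⟫_ℝ - ‖yosida Φ l x‖ ^ 2 / 2 * (l' - l))| ≤
      ‖yosida Φ l' x' - yosida Φ l x‖ * ‖x' - x‖
        + |‖yosida Φ l' x'‖ ^ 2 - ‖yosida Φ l x‖ ^ 2| / 2 * |l' - l| := by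
  -- The lower bounds at `(l, x)` and at `(l', x')` enclose the remainder between `0` and the
  -- variation of the candidate derivative.
  have hlower := hΦ.moreau_add_le hl hl' x x'
  have hupper := hΦ.moreau_add_le hl' hl x' x
  set q := yosida Φ l x
  set q' := yosida Φ l' x'
  rw [abs_of_nonneg (by linarith)]
  have hinner : ⟪q', x - x'⟫_ℝ = -(⟪q' - q, x' - x⟫_ℝ + ⟪q, x' - x⟫_ℝ) := by
    rw [← inner_add_left, sub_add_cancel, ← inner_neg_right, neg_sub]
  have hpoint := real_inner_le_norm (q' - q) (x' - x)
  have hindex : -((‖q'‖ ^ 2 - ‖q‖ ^ 2) / 2 * (l' - l)) ≤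
      |‖q'‖ ^ 2 - ‖q‖ ^ 2| / 2 * |l' - l| := by
    refine (neg_le_abs _).trans_eq ?_
    rw [abs_mul, abs_div, abs_two]
  linarith

lemma IsProperConvexLsc.hasFDerivAt_moreau (hΦ : IsProperConvexLsc Φ) (hl : 0 < l) (x : H) :
    HasFDerivAt (fun p : ℝ × H => moreau Φ p.1 p.2)
      ((innerSL ℝ (yosida Φ l x)).comp (ContinuousLinearMap.snd ℝ ℝ H)
        - (‖yosida Φ l x‖ ^ 2 / 2) • ContinuousLinearMap.fst ℝ ℝ H) (l, x) := by
  rw [hasFDerivAt_iff_isLittleO, Asymptotics.isLittleO_iff]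
  intro c hc
  have hcont := hΦ.continuousAt_yosida hl x
  have hvar : ContinuousAt (fun p : ℝ × H => ‖yosida Φ p.1 p.2 - yosida Φ l x‖
      + |‖yosida Φ p.1 p.2‖ ^ 2 - ‖yosida Φ l x‖ ^ 2| / 2) (l, x) := by fun_prop
  have hlim := hvar.tendsto
  simp only [sub_self, norm_zero, abs_zero, zero_div, add_zero] at hlim
  filter_upwards [continuousAt_fst.eventually (lt_mem_nhds hl),
    hlim.eventually (gt_mem_nhds hc)] with p hp hpc
  refine (hΦ.abs_moreau_sub_sub_le hl hp x p.2).trans ?_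
  calc _ ≤ ‖yosida Φ p.1 p.2 - yosida Φ l x‖ * ‖p - (l, x)‖
        + |‖yosida Φ p.1 p.2‖ ^ 2 - ‖yosida Φ l x‖ ^ 2| / 2 * ‖p - (l, x)‖ := by
        gcongr
        · exact norm_snd_le (p - (l, x))
        · exact norm_fst_le (p - (l, x))
    _ ≤ c * ‖p - (l, x)‖ := by rw [← add_mul]; gcongr

lemma IsProperConvexLsc.hasGradientAt_moreau (hΦ : IsProperConvexLsc Φ) (hl : 0 < l) (x : H) :
    HasGradientAt (moreau Φ l) (yosida Φ l x) x := by
  rw [hasGradientAt_iff_hasFDerivAt]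
  refine ((hΦ.hasFDerivAt_moreau hl x).comp x (hasFDerivAt_prodMk_right l x)).congr_fderiv ?_
  ext z
  simp

lemma IsProperConvexLsc.gradient_moreau (hΦ : IsProperConvexLsc Φ) (hl : 0 < l) (x : H) :
    gradient (moreau Φ l) x = yosida Φ l x :=
  (hΦ.hasGradientAt_moreau hl x).gradient

lemma IsProperConvexLsc.gradient_phi (hΦ : IsProperConvexLsc Φ) (e : ℝ) (hl : 0 < l) (x : H) :
    gradient (phi Φ e l) x = yosida Φ l x + e • x := by
  refine HasGradientAt.gradient ?_
  rw [hasGradientAt_iff_hasFDerivAt]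
  have hmoreau := hasGradientAt_iff_hasFDerivAt.1 (hΦ.hasGradientAt_moreau hl x)
  have hsq := ((hasStrictFDerivAt_norm_sq x).hasFDerivAt.const_mul e).mul_const (1 / 2)
  refine ((hmoreau.add hsq).congr_fderiv ?_).congr_of_eventuallyEq
    (Eventually.of_forall fun z => ?_)
  · ext z
    simp only [one_div, add_apply, InnerProductSpace.toDual_apply_apply, smul_apply,
      coe_innerSL_apply, nsmul_eq_mul, Nat.cast_ofNat, smul_eq_mul, map_add, map_smul,
      add_right_inj]
    ring
  · rw [phi, Pi.add_apply]
    ring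

lemma IsProperConvexLsc.hasDerivWithinAt_moreau (hΦ : IsProperConvexLsc Φ) {lam : ℝ → ℝ}
    {x : ℝ → H} {l' : ℝ} {x' : H} {s : Set ℝ} {t : ℝ} (hpos : 0 < lam t)
    (hl : HasDerivWithinAt lam l' s t) (hx : HasDerivWithinAt x x' s t) :
    HasDerivWithinAt (fun r => moreau Φ (lam r) (x r))
      (⟪yosida Φ (lam t) (x t), x'⟫_ℝ - l' / 2 * ‖yosida Φ (lam t) (x t)‖ ^ 2) s t := by
  refine ((hΦ.hasFDerivAt_moreau hpos (x t)).comp_hasDerivWithinAt t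
    (hl.prodMk hx)).congr_deriv ?_
  simp only [sub_apply, ContinuousLinearMap.comp_apply, ContinuousLinearMap.coe_snd',
    coe_innerSL_apply, smul_apply, ContinuousLinearMap.coe_fst', smul_eq_mul, sub_right_inj]
  ring

lemma IsProperConvexLsc.continuousOn_yosida (hΦ : IsProperConvexLsc Φ) {lam : ℝ → ℝ}
    {x : ℝ → H} {s : Set ℝ} (hpos : ∀ t ∈ s, 0 < lam t) (hl : ContinuousOn lam s)
    (hx : ContinuousOn x s) : ContinuousOn (fun t => yosida Φ (lam t) (x t)) s := fun t ht =>
  (hΦ.continuousAt_yosida (hpos t ht) (x t)).comp_continuousWithinAt (f := fun r => (lam r, x r))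
    ((hl t ht).prodMk (hx t ht))

lemma IsProperConvexLsc.exists_lipschitzOnWith_yosida (hΦ : IsProperConvexLsc Φ) {lam : ℝ → ℝ}
    {x : ℝ → H} {a b : ℝ} (hpos : ∀ t ∈ Icc a b, 0 < lam t) {K₁ K₂ : NNReal}
    (hl : LipschitzOnWith K₁ lam (Icc a b)) (hx : LipschitzOnWith K₂ x (Icc a b)) :
    ∃ K, LipschitzOnWith K (fun t => yosida Φ (lam t) (x t)) (Icc a b) := by
  obtain ⟨C, hC⟩ := isCompact_Icc.exists_bound_of_continuousOn
    (hΦ.continuousOn_yosida hpos hl.continuousOn hx.continuousOn)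
  obtain ⟨C', hC'⟩ := isCompact_Icc.exists_bound_of_continuousOn
    (hl.continuousOn.inv₀ fun t ht => (hpos t ht).ne')
  refine ⟨Real.toNNReal (C' * (K₂ + K₁ * C)), LipschitzOnWith.of_dist_le' fun t ht s hs => ?_⟩
  have hdiff := (hΦ.isSubgrad_yosida (hpos s hs) (x s)).mul_norm_sub_le
    (hΦ.isSubgrad_yosida (hpos t ht) (x t))
  have hlam := hl.dist_le_mul t ht s hs
  have hpoint := hx.dist_le_mul t ht s hs
  rw [dist_eq_norm] at hlam hpoint ⊢
  rw [Real.norm_eq_abs] at hlam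
  have hinv : (lam t)⁻¹ ≤ C' := (le_abs_self _).trans (hC' t ht)
  have hC'_nonneg : 0 ≤ C' := (inv_pos.2 (hpos t ht)).le.trans hinv
  calc _ = (lam t)⁻¹ * (lam t * ‖yosida Φ (lam t) (x t) - yosida Φ (lam s) (x s)‖) := by
        rw [inv_mul_cancel_left₀ (hpos t ht).ne']
    _ ≤ C' * (K₂ * dist t s + K₁ * dist t s * C) := by
        refine mul_le_mul hinv (hdiff.trans ?_)
          (mul_nonneg (hpos t ht).le (norm_nonneg _)) hC'_nonneg
        gcongr
        exact hC s hs
    _ = C' * (K₂ + K₁ * C) * dist t s := by ring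

end Moreau

section RegMin

variable {H : Type*} [NormedAddCommGroup H] [InnerProductSpace ℝ H] [CompleteSpace H]
  {Φ : H → EReal} {e l : ℝ}

lemma IsProperConvexLsc.phi_ge (hΦ : IsProperConvexLsc Φ) (e : ℝ) (hl : 0 < l) (x z : H) :
    phi Φ e l x + ⟪yosida Φ l x + e • x, z - x⟫_ℝ + e / 2 * ‖z - x‖ ^ 2 ≤ phi Φ e l z := by
  have hmoreau := hΦ.moreau_add_le hl hl x z
  have hsq : e * ‖z‖ ^ 2 / 2 = e * ‖x‖ ^ 2 / 2 + ⟪e • x, z - x⟫_ℝ + e / 2 * ‖z - x‖ ^ 2 := by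
    rw [norm_sub_sq_real, real_inner_smul_left, inner_sub_right, real_inner_self_eq_norm_sq,
      real_inner_comm]
    ring
  rw [phi, phi, inner_add_left, hsq]
  linarith

lemma IsProperConvexLsc.regMin_eq_of_yosida_eq (hΦ : IsProperConvexLsc Φ) (he : 0 < e)
    (hl : 0 < l) {y : H} (hy : yosida Φ l y = -(e • y)) : regMin Φ e l = y := by
  have hge : ∀ z, phi Φ e l y + e / 2 * ‖z - y‖ ^ 2 ≤ phi Φ e l z := fun z => by
    simpa only [hy, neg_add_cancel, inner_zero_left, add_zero] using hΦ.phi_ge e hl y z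
  have hmin : IsMinOn (phi Φ e l) univ y := fun z _ =>
    (le_add_of_nonneg_right (by positivity)).trans (hge z)
  have hspec : regMin Φ e l ∈ univ ∧ IsMinOn (phi Φ e l) univ (regMin Φ e l) :=
    Classical.epsilon_spec (p := fun z => z ∈ univ ∧ IsMinOn (phi Φ e l) univ z)
      ⟨y, mem_univ y, hmin⟩
  have hle : phi Φ e l (regMin Φ e l) ≤ phi Φ e l y := hspec.2 (mem_univ y)
  have hsq : e / 2 * ‖regMin Φ e l - y‖ ^ 2 ≤ 0 := by linarith [hge (regMin Φ e l)]
  have hnorm : ‖regMin Φ e l - y‖ ^ 2 = 0 :=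
    le_antisymm (nonpos_of_mul_nonpos_right hsq (half_pos he)) (sq_nonneg _)
  exact sub_eq_zero.1 (norm_eq_zero.1 (pow_eq_zero_iff two_ne_zero |>.1 hnorm))

lemma IsProperConvexLsc.yosida_neg_smul (hΦ : IsProperConvexLsc Φ) (he : 0 < e) (hl : 0 < l) :
    yosida Φ l (-(1 / e) • yosida Φ (1 / e + l) 0) = yosida Φ (1 / e + l) 0 := by
  have h := hΦ.isSubgrad_yosida (show 0 < 1 / e + l by positivity) 0
  refine hΦ.yosida_eq hl ?_
  convert h using 1
  module

lemma IsProperConvexLsc.regMin_eq (hΦ : IsProperConvexLsc Φ) (he : 0 < e) (hl : 0 < l) :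
    regMin Φ e l = -(1 / e) • yosida Φ (1 / e + l) 0 := by
  refine hΦ.regMin_eq_of_yosida_eq he hl ?_
  rw [hΦ.yosida_neg_smul he hl, smul_smul, mul_neg, mul_one_div_cancel he.ne', neg_smul, one_smul,
    neg_neg]

lemma IsProperConvexLsc.yosida_add_eq_neg_smul_regMin (hΦ : IsProperConvexLsc Φ) (he : 0 < e)
    (hl : 0 < l) : yosida Φ (1 / e + l) 0 = -(e • regMin Φ e l) := by
  rw [hΦ.regMin_eq he hl, smul_smul, mul_neg, mul_one_div_cancel he.ne', neg_smul, one_smul,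
    neg_neg]

lemma IsProperConvexLsc.yosida_regMin (hΦ : IsProperConvexLsc Φ) (he : 0 < e) (hl : 0 < l) :
    yosida Φ l (regMin Φ e l) = -(e • regMin Φ e l) := by
  rw [← hΦ.yosida_add_eq_neg_smul_regMin he hl, hΦ.regMin_eq he hl, hΦ.yosida_neg_smul he hl]

lemma IsProperConvexLsc.isSubgrad_regMin (hΦ : IsProperConvexLsc Φ) (he : 0 < e) (hl : 0 < l) :
    IsSubgrad Φ ((1 + l * e) • regMin Φ e l) (-(e • regMin Φ e l)) := by
  have h := hΦ.isSubgrad_yosida hl (regMin Φ e l)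
  rw [hΦ.yosida_regMin he hl] at h
  convert h using 1
  module

lemma IsProperConvexLsc.phi_regMin (hΦ : IsProperConvexLsc Φ) (he : 0 < e) (hl : 0 < l) :
    phi Φ e l (regMin Φ e l) = moreau Φ (1 / e + l) 0 := by
  -- An instance of the semigroup law of Moreau envelopes: `min φ_{e,l}` is the envelope of index
  -- `1 / e` of `Φ_l` at `0`.
  have hk : 0 < 1 / e + l := by positivity
  rw [phi, (hΦ.isSubgrad_yosida hl _).moreau_eq hΦ hl,
    (hΦ.isSubgrad_yosida hk 0).moreau_eq hΦ hk, hΦ.yosida_regMin he hl,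
    hΦ.yosida_add_eq_neg_smul_regMin he hl, norm_neg, norm_smul, Real.norm_of_nonneg he.le]
  have hpoint : regMin Φ e l - l • -(e • regMin Φ e l)
      = 0 - (1 / e + l) • -(e • regMin Φ e l) := by
    match_scalars
    field_simp
    ring
  rw [hpoint]
  field_simp
  ring

lemma IsProperConvexLsc.phi_regMin_le (hΦ : IsProperConvexLsc Φ) (he : 0 < e) (hl : 0 < l)
    (x : H) : phi Φ e l (regMin Φ e l) ≤ phi Φ e l x := by
  have hge := hΦ.phi_ge e hl (regMin Φ e l) x
  rw [hΦ.yosida_regMin he hl, neg_add_cancel, inner_zero_left, add_zero] at hge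
  exact (le_add_of_nonneg_right (by positivity)).trans hge

end RegMin

section Argmin

variable {H : Type*} [NormedAddCommGroup H] [InnerProductSpace ℝ H] {Φ : H → EReal}

lemma IsProperConvexLsc.ne_top_of_mem_argminSet (hΦ : IsProperConvexLsc Φ) {z : H}
    (hz : z ∈ argminSet Φ) : Φ z ≠ ⊤ := by
  obtain ⟨w, hw⟩ := hΦ.exists_ne_top
  exact ne_top_of_le_ne_top hw (hz w)

lemma IsProperConvexLsc.mem_argminSet_iff (hΦ : IsProperConvexLsc Φ) {z : H} :
    z ∈ argminSet Φ ↔ IsSubgrad Φ z 0 := by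
  refine ⟨fun hz => ⟨hΦ.ne_top_of_mem_argminSet hz, fun y hy => ?_⟩, fun ⟨hz, hsub⟩ y => ?_⟩
  · rw [inner_zero_left, add_zero]
    exact EReal.toReal_le_toReal (hz y) (hΦ.ne_bot _) hy
  · by_cases hy : Φ y = ⊤
    · rw [hy]; exact le_top
    rw [← hΦ.coe_toReal hy, hΦ.le_coe_iff]
    exact ⟨hz, by simpa only [inner_zero_left, add_zero] using hsub y hy⟩

lemma IsProperConvexLsc.isClosed_argminSet (hΦ : IsProperConvexLsc Φ) :
    IsClosed (argminSet Φ) := by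
  have hinter : argminSet Φ = ⋂ y, Φ ⁻¹' Iic (Φ y) := by ext; simp [argminSet]
  rw [hinter]
  exact isClosed_iInter fun y => hΦ.lsc.isClosed_preimage (Φ y)

lemma IsProperConvexLsc.convex_argminSet (hΦ : IsProperConvexLsc Φ) :
    Convex ℝ (argminSet Φ) := by
  intro x hx y hy a b ha hb hab
  rw [hΦ.mem_argminSet_iff] at hx hy ⊢
  refine ⟨hΦ.convexOn_toReal.1 hx.1 hy.1 ha hb hab, fun z hz => ?_⟩
  have hxz := hx.2 z hz
  have hyz := hy.2 z hz
  simp only [inner_zero_left, add_zero] at hxz hyz ⊢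
  calc _ ≤ a * (Φ x).toReal + b * (Φ y).toReal := hΦ.convexOn_toReal.2 hx.1 hy.1 ha hb hab
    _ ≤ a * (Φ z).toReal + b * (Φ z).toReal := by gcongr
    _ = (Φ z).toReal := by rw [← add_mul, hab, one_mul]

lemma IsProperConvexLsc.norm_regMin_le [CompleteSpace H] (hΦ : IsProperConvexLsc Φ) {e l : ℝ}
    (he : 0 < e) (hl : 0 < l) {z : H} (hz : z ∈ argminSet Φ) : ‖regMin Φ e l‖ ≤ ‖z‖ := by
  have hmono := (hΦ.mem_argminSet_iff.1 hz).monotone (hΦ.isSubgrad_regMin he hl)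
  set y := regMin Φ e l
  rw [sub_zero, inner_neg_left, real_inner_smul_left, inner_sub_right, real_inner_smul_right,
    real_inner_self_eq_norm_sq] at hmono
  have hinner : (1 + l * e) * ‖y‖ ^ 2 - ⟪y, z⟫_ℝ ≤ 0 :=
    nonpos_of_mul_nonpos_right (by linarith) he
  have hle : 0 ≤ l * e * ‖y‖ ^ 2 := by positivity
  rcases (norm_nonneg y).eq_or_lt with hzero | hpos
  · rw [← hzero]; exact norm_nonneg z
  · refine le_of_mul_le_mul_left ?_ hpos
    linarith [real_inner_le_norm y z]

lemma IsProperConvexLsc.minNormSol_mem [CompleteSpace H] (hΦ : IsProperConvexLsc Φ)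
    (hne : (argminSet Φ).Nonempty) : minNormSol Φ ∈ argminSet Φ := by
  obtain ⟨v, hv, hmin⟩ := exists_norm_eq_iInf_of_complete_convex hne
    hΦ.isClosed_argminSet.isComplete hΦ.convex_argminSet 0
  have hvmin : IsMinOn (fun z : H => ‖z‖) (argminSet Φ) v := fun z hz => by
    have hle : (⨅ w : argminSet Φ, ‖0 - (w : H)‖) ≤ ‖0 - z‖ :=
      ciInf_le ⟨0, by rintro _ ⟨w, rfl⟩; exact norm_nonneg _⟩ (⟨z, hz⟩ : argminSet Φ)
    rw [← hmin] at hle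
    simpa using hle
  exact (Classical.epsilon_spec
    (p := fun z => z ∈ argminSet Φ ∧ IsMinOn (fun z : H => ‖z‖) (argminSet Φ) z)
    ⟨v, hv, hvmin⟩).1

end Argmin

section RegMinVariation

variable {H : Type*} [NormedAddCommGroup H] [InnerProductSpace ℝ H]

lemma norm_le_max_abs_mul_norm {w y : H} {a b : ℝ} (h : ⟪w - a • y, w - b • y⟫_ℝ ≤ 0) :
    ‖w‖ ≤ max |a| |b| * ‖y‖ := by
  -- The hypothesis places `w` in the ball having `[a • y, b • y]` as a diameter.
  have hball : ‖w - ((a + b) / 2) • y‖ ≤ |a - b| / 2 * ‖y‖ := by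
    have hexpand : ⟪w - a • y, w - b • y⟫_ℝ =
        ‖w - ((a + b) / 2) • y‖ ^ 2 - (|a - b| / 2 * ‖y‖) ^ 2 := by
      rw [mul_pow, div_pow, sq_abs]
      simp only [← real_inner_self_eq_norm_sq, inner_sub_left, inner_sub_right,
        real_inner_smul_left, real_inner_smul_right, real_inner_comm w y]
      ring
    exact (pow_le_pow_iff_left₀ (norm_nonneg _) (by positivity) two_ne_zero).1 (by linarith)
  have hmax : |(a + b) / 2| + |a - b| / 2 ≤ max |a| |b| := by
    rw [abs_div, abs_two]
    grind
  calc ‖w‖ ≤ ‖((a + b) / 2) • y‖ + ‖w - ((a + b) / 2) • y‖ := norm_le_norm_add_norm_sub' _ _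
    _ ≤ |(a + b) / 2| * ‖y‖ + |a - b| / 2 * ‖y‖ := by
        rw [norm_smul, Real.norm_eq_abs]; gcongr
    _ ≤ max |a| |b| * ‖y‖ := by rw [← add_mul]; gcongr

lemma IsProperConvexLsc.norm_regMin_sub_le [CompleteSpace H] {Φ : H → EReal}
    (hΦ : IsProperConvexLsc Φ) {e l e' l' : ℝ} (he : 0 < e) (hl : 0 < l) (he' : 0 < e')
    (hl' : 0 < l') :
    ‖regMin Φ e' l' - regMin Φ e l‖ ≤
      max |e / e' - 1| |(1 + l * e) / (1 + l' * e') - 1| * ‖regMin Φ e l‖ := by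
  refine norm_le_max_abs_mul_norm ?_
  have hmono := (hΦ.isSubgrad_regMin he hl).monotone (hΦ.isSubgrad_regMin he' hl')
  set y := regMin Φ e l
  set y' := regMin Φ e' l'
  have hk : 0 < 1 + l' * e' := by positivity
  have hdual : -(e' • y') - -(e • y) = (-e') • (y' - y - (e / e' - 1) • y) := by
    (match_scalars <;> field_simp); ring
  have hprimal : (1 + l' * e') • y' - (1 + l * e) • y =
      (1 + l' * e') • (y' - y - ((1 + l * e) / (1 + l' * e') - 1) • y) := by
    (match_scalars <;> field_simp); ring
  rw [hdual, hprimal, real_inner_smul_left, real_inner_smul_right] at hmono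
  refine nonpos_of_mul_nonpos_right (a := (1 + l' * e') * e') ?_ (by positivity)
  linarith

end RegMinVariation

section DerivativeComparison

variable {H : Type*} [NormedAddCommGroup H] [InnerProductSpace ℝ H]

lemma half_norm_sub_smul_sq_le {u y₀ y : H} {ρ δ : ℝ} (hρ : 0 ≤ ρ) (hy : ‖y - y₀‖ ≤ δ) :
    1 / 2 * ‖u - ρ • y‖ ^ 2 ≤
      1 / 2 * ‖u - ρ • y₀‖ ^ 2 + ‖u - ρ • y₀‖ * (ρ * δ) + 1 / 2 * (ρ * δ) ^ 2 := by
  have htriangle : ‖u - ρ • y‖ ≤ ‖u - ρ • y₀‖ + ρ * δ := by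
    calc ‖u - ρ • y‖ = ‖(u - ρ • y₀) - ρ • (y - y₀)‖ := by congr 1; module
      _ ≤ ‖u - ρ • y₀‖ + ‖ρ • (y - y₀)‖ := norm_sub_le _ _
      _ ≤ ‖u - ρ • y₀‖ + ρ * δ := by rw [norm_smul, Real.norm_of_nonneg hρ]; gcongr
  calc _ ≤ 1 / 2 * (‖u - ρ • y₀‖ + ρ * δ) ^ 2 := by gcongr
    _ = _ := by ring

lemma hasDerivAt_le_of_half_norm_sq_of_norm_sub_le {u y : ℝ → H} {ρ N : ℝ → ℝ} {u' : H}
    {ρ' N' L t : ℝ} (hu : HasDerivAt u u' t) (hρ : HasDerivAt ρ ρ' t) (hρ_nonneg : ∀ r, 0 ≤ ρ r)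
    (hy : ∀ᶠ r in 𝓝[>] t, ‖y r - y t‖ ≤ L * (r - t)) (hN : HasDerivAt N N' t)
    (hNe : ∀ᶠ r in 𝓝[≥] t, N r = 1 / 2 * ‖u r - ρ r • y r‖ ^ 2) :
    N' ≤ ⟪u t - ρ t • y t, u' - ρ' • y t⟫_ℝ + ρ t * L * ‖u t - ρ t • y t‖ := by
  have hle : 𝓝[>] t ≤ 𝓝[≠] t := nhdsWithin_mono _ fun r hr => ne_of_gt hr
  have hv := hu.fun_sub (hρ.smul_const (y t))
  have hslope := (hasDerivAt_iff_tendsto_slope.1 (hv.norm_sq.const_mul (1 / 2))).mono_left hle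
  have hrest : Tendsto (fun r => ‖u r - ρ r • y t‖ * (ρ r * L) + 1 / 2 * (ρ r * L) ^ 2 * (r - t))
      (𝓝[>] t) (𝓝 (‖u t - ρ t • y t‖ * (ρ t * L) + 1 / 2 * (ρ t * L) ^ 2 * (t - t))) :=
    ContinuousAt.tendsto (x := t) (((hv.continuousAt.norm).mul (hρ.continuousAt.mul_const L)).add
      ((((hρ.continuousAt.mul_const L).pow 2).const_mul _).mul (by fun_prop)))
      |>.mono_left nhdsWithin_le_nhds
  have hmain := le_of_tendsto_of_tendsto ((hasDerivAt_iff_tendsto_slope.1 hN).mono_left hle)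
    (hslope.add hrest) ?_
  · linarith
  filter_upwards [hy, nhdsWithin_mono _ Ioi_subset_Ici_self hNe, self_mem_nhdsWithin]
    with r hyr hNr hr
  have hrt : 0 < r - t := sub_pos.2 hr
  rw [slope_def_field, slope_def_field, hNr, hNe.self_of_nhdsWithin self_mem_Ici,
    div_le_iff₀ hrt, add_mul, div_mul_cancel₀ _ hrt.ne']
  linarith [half_norm_sub_smul_sq_le (u := u r) (hρ_nonneg r) hyr]

end DerivativeComparison

section Parameters

lemma hasDerivAt_dt {F : Type*} [NormedAddCommGroup F] [NormedSpace ℝ F] {t₀ t : ℝ} {f : ℝ → F}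
    (hf : DifferentiableOn ℝ f (Ici t₀)) (ht : t₀ < t) : HasDerivAt f (dt t₀ f t) t :=
  (hf t ht.le).hasDerivWithinAt.hasDerivAt (Ici_mem_nhds ht)

lemma contDiffOn_one_Ici {F : Type*} [NormedAddCommGroup F] [NormedSpace ℝ F] {t₀ : ℝ}
    {f f' : ℝ → F} (hf : ∀ t, t₀ ≤ t → HasDerivWithinAt f (f' t) (Ici t₀) t)
    (hf' : ContinuousOn f' (Ici t₀)) : ContDiffOn ℝ 1 f (Ici t₀) := by
  have hu := uniqueDiffOn_Ici t₀
  rw [contDiffOn_one_iff_derivWithin hu]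
  exact ⟨fun t ht => (hf t ht).differentiableWithinAt,
    hf'.congr fun t ht => (hf t ht).derivWithin (hu t ht)⟩

/-- The standing assumptions on the Moreau index `lam` and the Tikhonov parameter `eps` as
functions of time on `[t₀, ∞)`. -/
structure IsParameterPair (t₀ : ℝ) (lam eps : ℝ → ℝ) : Prop where
  lam_pos : ∀ t, t₀ ≤ t → 0 < lam t
  lam_contDiffOn : ContDiffOn ℝ 1 lam (Ici t₀)
  lam_mono : MonotoneOn lam (Ici t₀)
  eps_pos : ∀ t, t₀ ≤ t → 0 < eps t
  eps_contDiffOn : ContDiffOn ℝ 1 eps (Ici t₀)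
  eps_anti : AntitoneOn eps (Ici t₀)

namespace IsParameterPair

variable {α β γ a c t₀ t : ℝ} {lam eps : ℝ → ℝ}

lemma hasDerivAt_lam (h : IsParameterPair t₀ lam eps) (ht : t₀ < t) :
    HasDerivAt lam (dt t₀ lam t) t :=
  hasDerivAt_dt (h.lam_contDiffOn.differentiableOn one_ne_zero) ht

lemma hasDerivAt_eps (h : IsParameterPair t₀ lam eps) (ht : t₀ < t) :
    HasDerivAt eps (dt t₀ eps t) t :=
  hasDerivAt_dt (h.eps_contDiffOn.differentiableOn one_ne_zero) ht

lemma dt_lam_nonneg (h : IsParameterPair t₀ lam eps) : 0 ≤ dt t₀ lam t :=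
  h.lam_mono.derivWithin_nonneg

lemma dt_eps_nonpos (h : IsParameterPair t₀ lam eps) : dt t₀ eps t ≤ 0 :=
  h.eps_anti.derivWithin_nonpos

lemma continuousOn_dt_lam (h : IsParameterPair t₀ lam eps) : ContinuousOn (dt t₀ lam) (Ici t₀) :=
  h.lam_contDiffOn.continuousOn_derivWithin (uniqueDiffOn_Ici t₀) le_rfl

lemma continuousOn_dt_eps (h : IsParameterPair t₀ lam eps) : ContinuousOn (dt t₀ eps) (Ici t₀) :=
  h.eps_contDiffOn.continuousOn_derivWithin (uniqueDiffOn_Ici t₀) le_rfl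

lemma contDiffOn_sqrt (h : IsParameterPair t₀ lam eps) :
    ContDiffOn ℝ 1 (fun t => √(eps t)) (Ici t₀) :=
  h.eps_contDiffOn.sqrt fun t ht => (h.eps_pos t ht).ne'

lemma contDiffOn_one_div (h : IsParameterPair t₀ lam eps) :
    ContDiffOn ℝ 1 (fun t => 1 / eps t) (Ici t₀) :=
  contDiffOn_const.div h.eps_contDiffOn fun t ht => (h.eps_pos t ht).ne'

lemma contDiffOn_index (h : IsParameterPair t₀ lam eps) :
    ContDiffOn ℝ 1 (fun t => 1 / eps t + lam t) (Ici t₀) :=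
  h.contDiffOn_one_div.add h.lam_contDiffOn

lemma index_pos (h : IsParameterPair t₀ lam eps) (ht : t₀ ≤ t) : 0 < 1 / eps t + lam t :=
  add_pos (one_div_pos.2 (h.eps_pos t ht)) (h.lam_pos t ht)

lemma dt_one_div_sqrt (h : IsParameterPair t₀ lam eps) (ht : t₀ < t) :
    dt t₀ (fun s => 1 / √(eps s)) t = -(dt t₀ eps t / (2 * eps t)) / √(eps t) := by
  have he := h.eps_pos t ht.le
  have hderiv := (((h.hasDerivAt_eps ht).sqrt he.ne').hasDerivWithinAt (s := Ici t₀)).fun_inv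
    (Real.sqrt_pos.2 he).ne'
  simp only [one_div]
  rw [dt, hderiv.derivWithin (uniqueDiffOn_Ici t₀ t ht.le), Real.sq_sqrt he.le]
  field_simp

lemma continuousOn_mu (h : IsParameterPair t₀ lam eps) : ContinuousOn (mu α γ t₀ eps) (Ici t₀) :=
  (continuousOn_const.mul h.contDiffOn_sqrt.continuousOn).sub
    (h.continuousOn_dt_eps.div (continuousOn_const.mul h.eps_contDiffOn.continuousOn)
      fun t ht => (mul_pos two_pos (h.eps_pos t ht)).ne')

lemma mu_nonneg (h : IsParameterPair t₀ lam eps) (hγα : γ ≤ α) (ht : t₀ ≤ t) :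
    0 ≤ mu α γ t₀ eps t :=
  sub_nonneg.2 ((div_nonpos_of_nonpos_of_nonneg h.dt_eps_nonpos
    (mul_pos two_pos (h.eps_pos t ht)).le).trans
      (mul_nonneg (sub_nonneg.2 hγα) (Real.sqrt_nonneg _)))

lemma continuousOn_gfun (h : IsParameterPair t₀ lam eps) :
    ContinuousOn (gfun β γ a c t₀ lam eps) (Ici t₀) := by
  have hdl := h.continuousOn_dt_lam
  have hde := h.continuousOn_dt_eps
  have he := h.eps_contDiffOn.continuousOn
  have hs := h.contDiffOn_sqrt.continuousOn
  have hlrate := ((continuousOn_const (c := (2 : ℝ))).mul hdl).div h.lam_contDiffOn.continuousOn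
    fun t ht => (h.lam_pos t ht).ne'
  have herate := hde.div he fun t ht => (h.eps_pos t ht).ne'
  exact (((hdl.mul (he.pow 2)).sub hde).add
    (((continuousOn_const.mul hde).mul hs).div_const 2)).add
    ((continuousOn_const.mul hs).mul ((hlrate.sub herate).pow 2))

lemma gfun_nonneg (h : IsParameterPair t₀ lam eps) (hγ : 0 ≤ γ) (ha : 0 ≤ a) (hc : 0 ≤ c)
    (hs : γ * β * √(eps t) ≤ 2) : 0 ≤ gfun β γ a c t₀ lam eps t := by
  have hdl : 0 ≤ dt t₀ lam t * eps t ^ 2 := mul_nonneg h.dt_lam_nonneg (sq_nonneg _)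
  have hde : 0 ≤ -dt t₀ eps t * (1 - γ * β * √(eps t) / 2) :=
    mul_nonneg (neg_nonneg.2 h.dt_eps_nonpos) (by linarith)
  have hrate : 0 ≤ γ * (2 * a + c * γ) * √(eps t)
      * (2 * dt t₀ lam t / lam t - dt t₀ eps t / eps t) ^ 2 := by positivity
  rw [gfun]
  linarith

lemma hasDerivAt_eps_div_sub_one (h : IsParameterPair t₀ lam eps) (ht : t₀ < t) :
    HasDerivAt (fun r => eps t / eps r - 1) (-(dt t₀ eps t / eps t)) t := by
  have he := (h.eps_pos t ht.le).ne'
  refine ((((h.hasDerivAt_eps ht).fun_inv he).const_mul (eps t)).sub_const 1).congr_deriv ?_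
  field_simp

lemma hasDerivAt_one_add_div_sub_one (h : IsParameterPair t₀ lam eps) (ht : t₀ < t) :
    HasDerivAt (fun r => (1 + lam t * eps t) / (1 + lam r * eps r) - 1)
      (-((dt t₀ lam t * eps t + lam t * dt t₀ eps t) / (1 + lam t * eps t))) t := by
  have hpos : 0 < 1 + lam t * eps t :=
    add_pos one_pos (mul_pos (h.lam_pos t ht.le) (h.eps_pos t ht.le))
  refine ((((((h.hasDerivAt_lam ht).fun_mul (h.hasDerivAt_eps ht)).const_add 1).fun_inv
    hpos.ne').const_mul (1 + lam t * eps t)).sub_const 1).congr_deriv ?_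
  field_simp

lemma abs_rate_le (h : IsParameterPair t₀ lam eps) (ht : t₀ ≤ t) :
    |(dt t₀ lam t * eps t + lam t * dt t₀ eps t) / (1 + lam t * eps t)| ≤
      2 * dt t₀ lam t / lam t - dt t₀ eps t / eps t := by
  have he := h.eps_pos t ht
  have hl := h.lam_pos t ht
  obtain ⟨p, hp⟩ : ∃ p, dt t₀ lam t = p * lam t := ⟨_, (div_mul_cancel₀ _ hl.ne').symm⟩
  obtain ⟨q, hq⟩ : ∃ q, dt t₀ eps t = -q * eps t :=
    ⟨-(dt t₀ eps t / eps t), by field_simp⟩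
  have hp_nonneg : 0 ≤ p := nonneg_of_mul_nonneg_left (hp ▸ h.dt_lam_nonneg) hl
  have hq_nonneg : 0 ≤ q := neg_nonpos.1 (nonpos_of_mul_nonpos_left (hq ▸ h.dt_eps_nonpos) he)
  have hle : 0 ≤ lam t * eps t := by positivity
  have hrate : 2 * (p * lam t) / lam t - -q * eps t / eps t = 2 * p + q := by
    field_simp
    ring
  rw [hp, hq, hrate, abs_div, abs_of_pos (by positivity : 0 < 1 + lam t * eps t),
    div_le_iff₀ (by positivity), abs_le]
  have hp_mul := mul_nonneg hp_nonneg hle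
  have hq_mul := mul_nonneg hq_nonneg hle
  constructor <;> linarith

variable {H : Type*} [NormedAddCommGroup H] [InnerProductSpace ℝ H] [CompleteSpace H]
  {Φ : H → EReal}

lemma continuousOn_regMin (h : IsParameterPair t₀ lam eps) (hΦ : IsProperConvexLsc Φ) :
    ContinuousOn (fun t => regMin Φ (eps t) (lam t)) (Ici t₀) :=
  (h.contDiffOn_one_div.continuousOn.neg.smul (hΦ.continuousOn_yosida
    (fun _ ht => h.index_pos ht) h.contDiffOn_index.continuousOn continuousOn_const)).congr
    fun t ht => hΦ.regMin_eq (h.eps_pos t ht) (h.lam_pos t ht)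

lemma eventually_norm_regMin_sub_le (h : IsParameterPair t₀ lam eps) (hΦ : IsProperConvexLsc Φ)
    (ht : t₀ < t) {L : ℝ} (hL : 2 * dt t₀ lam t / lam t - dt t₀ eps t / eps t < L) :
    ∀ᶠ r in 𝓝[>] t, ‖regMin Φ (eps r) (lam r) - regMin Φ (eps t) (lam t)‖ ≤
      L * ‖regMin Φ (eps t) (lam t)‖ * (r - t) := by
  have he := h.eps_pos t ht.le
  have hl := h.lam_pos t ht.le
  have hderiv_eps : ‖-(dt t₀ eps t / eps t)‖ < L := by
    have hde : dt t₀ eps t / eps t ≤ 0 := div_nonpos_of_nonpos_of_nonneg h.dt_eps_nonpos he.le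
    have hdl : 0 ≤ 2 * dt t₀ lam t / lam t :=
      div_nonneg (mul_nonneg zero_le_two h.dt_lam_nonneg) hl.le
    rw [norm_neg, Real.norm_of_nonpos hde]
    linarith
  have hderiv_index := (abs_rate_le h ht.le).trans_lt hL
  rw [← abs_neg, ← Real.norm_eq_abs] at hderiv_index
  filter_upwards [self_mem_nhdsWithin,
    ((h.hasDerivAt_eps_div_sub_one ht).hasDerivWithinAt).limsup_norm_slope_le hderiv_eps,
    ((h.hasDerivAt_one_add_div_sub_one ht).hasDerivWithinAt).limsup_norm_slope_le hderiv_index]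
    with r hr heps hindex
  have hrt : 0 < r - t := sub_pos.2 hr
  have htr : t₀ ≤ r := (ht.trans hr).le
  rw [div_self he.ne', sub_self, sub_zero, Real.norm_of_nonneg hrt.le,
    inv_mul_lt_iff₀ hrt, Real.norm_eq_abs] at heps
  rw [div_self (by positivity), sub_self, sub_zero, Real.norm_of_nonneg hrt.le,
    inv_mul_lt_iff₀ hrt, Real.norm_eq_abs] at hindex
  calc _ ≤ _ := hΦ.norm_regMin_sub_le he hl (h.eps_pos r htr) (h.lam_pos r htr)
    _ ≤ (r - t) * L * ‖regMin Φ (eps t) (lam t)‖ := by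
        gcongr
        exact max_le heps.le hindex.le
    _ = _ := by ring

lemma hasDerivWithinAt_moreau_index (h : IsParameterPair t₀ lam eps) (hΦ : IsProperConvexLsc Φ)
    {de dl : ℝ} {s : Set ℝ} (ht : t₀ ≤ t) (hde : HasDerivWithinAt eps de s t)
    (hdl : HasDerivWithinAt lam dl s t) :
    HasDerivWithinAt (fun r => moreau Φ (1 / eps r + lam r) 0)
      ((de - dl * eps t ^ 2) / 2 * ‖regMin Φ (eps t) (lam t)‖ ^ 2) s t := by
  have he := h.eps_pos t ht
  have hderiv := hΦ.hasDerivWithinAt_moreau (lam := fun r => 1 / eps r + lam r)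
    (x := fun _ => (0 : H)) (h.index_pos ht)
    (((hasDerivWithinAt_const t s (1 : ℝ)).fun_div hde he.ne').fun_add hdl)
    (hasDerivWithinAt_const t s (0 : H))
  refine hderiv.congr_deriv ?_
  rw [hΦ.yosida_add_eq_neg_smul_regMin he (h.lam_pos t ht), inner_zero_right, norm_neg,
    norm_smul, Real.norm_of_nonneg he.le]
  field_simp
  ring

end IsParameterPair

end Parameters

section PointwiseEnergy

variable {H : Type*} [NormedAddCommGroup H] [InnerProductSpace ℝ H]

lemma inner_add_half_mul_norm_sq (U v Q : H) (k τ : ℝ) :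
    ⟪U + v + Q, -(τ • U) - k • v⟫_ℝ + (k + τ) / 2 * ‖U + v + Q‖ ^ 2 =
      τ / 2 * (‖v + Q‖ ^ 2 - ‖U‖ ^ 2) + k / 2 * (‖U + Q‖ ^ 2 - ‖v‖ ^ 2) := by
  simp only [← real_inner_self_eq_norm_sq, inner_add_left, inner_add_right, inner_sub_right,
    inner_neg_right, real_inner_smul_right, real_inner_comm U v, real_inner_comm U Q,
    real_inner_comm v Q]
  ring

lemma sub_mul_norm_add_sq_le {B κ : ℝ} (hB : 0 ≤ B) (hκ : 0 < κ) (v Q : H) :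
    (B - κ) * ‖v + Q‖ ^ 2 ≤ B * ‖v‖ ^ 2 + B ^ 2 / κ * ‖Q‖ ^ 2 := by
  have hsq : 0 ≤ κ * ‖(v + Q) - (B / κ) • Q‖ ^ 2 := by positivity
  have hexpand : κ * ‖(v + Q) - (B / κ) • Q‖ ^ 2 =
      κ * ‖v + Q‖ ^ 2 - 2 * B * ⟪v + Q, Q⟫_ℝ + B ^ 2 / κ * ‖Q‖ ^ 2 := by
    rw [norm_sub_sq_real, real_inner_smul_right, norm_smul, mul_pow, Real.norm_eq_abs, sq_abs]
    field_simp
  have hv : ‖v‖ ^ 2 = ‖v + Q‖ ^ 2 - 2 * ⟪v + Q, Q⟫_ℝ + ‖Q‖ ^ 2 := by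
    rw [← norm_sub_sq_real, add_sub_cancel_right]
  rw [hv]
  linarith [mul_nonneg hB (sq_nonneg ‖Q‖)]

lemma norm_add_sq_le_two_mul (U Q : H) : ‖U + Q‖ ^ 2 ≤ 2 * ‖U‖ ^ 2 + 2 * ‖Q‖ ^ 2 := by
  have h := parallelogram_law_with_norm ℝ U Q
  nlinarith [sq_nonneg ‖U - Q‖]

lemma kinetic_remainder_le {a c γ δ s τ D : ℝ} (ha : 0 < a) (hc : 0 < c) (hγ : 0 < γ)
    (hδ : 0 ≤ δ) (hs : 0 ≤ s) (hτ : 0 ≤ τ) (hD : 0 ≤ D) (hτδ : τ ≤ (δ - γ / a) * s) (U v Q : H) :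
    τ * ⟪Q, U⟫_ℝ + τ / 2 * (‖v + Q‖ ^ 2 - ‖U‖ ^ 2) + δ * s / 2 * (‖U + Q‖ ^ 2 - ‖v‖ ^ 2)
        + γ * s * D * ‖U + v + Q‖ ≤
      s * (δ + 1 / (2 * c)) * ‖U‖ ^ 2 + s * (a * δ ^ 2 / γ + 3 * δ / 2) * ‖Q‖ ^ 2
        + γ * (2 * a + c * γ) / 2 * s * D ^ 2 := by
  have hQU : τ * ⟪Q, U⟫_ℝ - τ / 2 * ‖U‖ ^ 2 ≤ τ / 2 * ‖Q‖ ^ 2 := by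
    nlinarith [norm_sub_sq_real Q U, sq_nonneg ‖Q - U‖]
  have hUQ : δ * s / 2 * ‖U + Q‖ ^ 2 ≤ δ * s / 2 * (2 * ‖U‖ ^ 2 + 2 * ‖Q‖ ^ 2) := by
    gcongr
    exact norm_add_sq_le_two_mul U Q
  have hW : γ * s * D * ‖U + v + Q‖ ≤ γ * s * (D * ‖U‖) + γ * s * (D * ‖v + Q‖) := by
    calc _ ≤ γ * s * D * (‖U‖ + ‖v + Q‖) := by
          rw [add_assoc]; gcongr; exact norm_add_le _ _
      _ = _ := by ring
  -- The Young weights `c γ` on `U` and `2 a` on `v + Q` add up to the coefficient of `D ^ 2`.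
  have hγs : 0 ≤ γ * s / 2 := by positivity
  have hyoungU := mul_le_mul_of_nonneg_left
    (two_mul_le_add_mul_sq (a := D) (b := ‖U‖) (mul_pos hc hγ)) hγs
  have hyoungV := mul_le_mul_of_nonneg_left
    (two_mul_le_add_mul_sq (a := D) (b := ‖v + Q‖) (mul_pos two_pos ha)) hγs
  have hτV : τ / 2 * ‖v + Q‖ ^ 2 ≤ (δ - γ / a) * s / 2 * ‖v + Q‖ ^ 2 := by gcongr
  have hτQ : τ / 2 * ‖Q‖ ^ 2 ≤ δ * s / 2 * ‖Q‖ ^ 2 := by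
    gcongr
    exact hτδ.trans (mul_le_mul_of_nonneg_right (sub_le_self δ (by positivity)) hs)
  have habsorb := mul_le_mul_of_nonneg_left
    (sub_mul_norm_add_sq_le (div_nonneg hδ zero_le_two) (by positivity : 0 < γ / (4 * a)) v Q) hs
  have hcoefU : γ * s / 2 * ((c * γ)⁻¹ * ‖U‖ ^ 2) = s * (1 / (2 * c)) * ‖U‖ ^ 2 := by field_simp
  have hcoefQ : (δ / 2) ^ 2 / (γ / (4 * a)) = a * δ ^ 2 / γ := by field_simp; norm_num
  rw [hcoefQ] at habsorb
  have hcoefV : γ * s / 2 * ((2 * a)⁻¹ * ‖v + Q‖ ^ 2) = γ / a * s / 4 * ‖v + Q‖ ^ 2 := by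
    field_simp
    ring
  have hcoefκ : γ / (4 * a) = γ / a / 4 := by field_simp
  rw [mul_add, hcoefU] at hyoungU
  rw [mul_add, hcoefV] at hyoungV
  rw [hcoefκ] at habsorb
  linarith

lemma potential_rate_le {x y v q : H} {α β γ s τ Δ : ℝ} (hγ : 0 ≤ γ) (hβ : 0 ≤ β) (hs : 0 ≤ s)
    (hτ : 0 ≤ τ) (hΔ : 0 ≤ Δ) (hτ_le : τ ≤ (2 * γ - α + γ * β * τ) * s)
    (hle_τ : β * s ^ 2 ≤ (2 - γ * β * s) * τ)
    (hstrong : Δ + s ^ 2 / 2 * ‖x - y‖ ^ 2 ≤ ⟪q + s ^ 2 • x, x - y⟫_ℝ) :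
    ⟪q + s ^ 2 • x, v⟫_ℝ - ⟪(γ * s) • (x - y) + v + β • q, q + s ^ 2 • x⟫_ℝ
        + β / 2 * ‖q + s ^ 2 • x‖ ^ 2 - s ^ 2 * τ * ‖x‖ ^ 2 + ((α - γ) * s + τ) * Δ
        + γ * β * s ^ 3 * τ / 2 * ‖y‖ ^ 2 ≤
      τ * ⟪β • q, (γ * s) • (x - y)⟫_ℝ - γ * s ^ 3 / 2 * ‖x - y‖ ^ 2 - β / 2 * ‖q‖ ^ 2 := by
  have hexpand : ⟪q + s ^ 2 • x, v⟫_ℝ - ⟪(γ * s) • (x - y) + v + β • q, q + s ^ 2 • x⟫_ℝ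
      + β / 2 * ‖q + s ^ 2 • x‖ ^ 2 =
      -(γ * s * ⟪q + s ^ 2 • x, x - y⟫_ℝ) + β * s ^ 4 / 2 * ‖x‖ ^ 2 - β / 2 * ‖q‖ ^ 2 := by
    have hnorm : ‖q + s ^ 2 • x‖ ^ 2 = ‖q‖ ^ 2 + 2 * s ^ 2 * ⟪q, x⟫_ℝ + s ^ 4 * ‖x‖ ^ 2 := by
      rw [norm_add_sq_real, real_inner_smul_right, norm_smul, mul_pow, Real.norm_eq_abs, sq_abs]
      ring
    have hW : ⟪(γ * s) • (x - y) + v + β • q, q + s ^ 2 • x⟫_ℝ =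
        γ * s * ⟪q + s ^ 2 • x, x - y⟫_ℝ + ⟪q + s ^ 2 • x, v⟫_ℝ
          + β * (‖q‖ ^ 2 + s ^ 2 * ⟪q, x⟫_ℝ) := by
      rw [inner_add_left, inner_add_left, real_inner_smul_left, real_inner_smul_left,
        real_inner_comm _ (x - y), real_inner_comm _ v, inner_add_right q,
        real_inner_self_eq_norm_sq, real_inner_smul_right]
    rw [hnorm, hW]
    ring
  have hx : s ^ 2 / 2 * (β * s ^ 2 * ‖x‖ ^ 2) ≤ s ^ 2 / 2 * ((2 - γ * β * s) * τ * ‖x‖ ^ 2) := by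
    gcongr
  have hinner : ⟪q + s ^ 2 • x, x - y⟫_ℝ =
      ⟪q, x - y⟫_ℝ + s ^ 2 / 2 * (‖x‖ ^ 2 - ‖y‖ ^ 2 + ‖x - y‖ ^ 2) := by
    rw [inner_add_left, real_inner_smul_left, inner_sub_right x, real_inner_self_eq_norm_sq,
      norm_sub_sq_real]
    ring
  have hdecay := mul_le_mul_of_nonneg_left hstrong (mul_nonneg hγ hs)
  have hconvex := mul_le_mul_of_nonneg_left (hinner ▸ hstrong)
    (by positivity : 0 ≤ γ * β * s * τ)
  have hcoefΔ := mul_le_mul_of_nonneg_right hτ_le hΔ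
  rw [hexpand, real_inner_smul_left, real_inner_smul_right]
  linarith

lemma energy_rate_le {x y v q : H} {α β γ a c s τ D Δ : ℝ} (hβ : 0 ≤ β) (hγ : 0 < γ)
    (hγα : γ ≤ α) (ha : 0 < a) (hc : 0 < c) (hs : 0 ≤ s) (hτ : 0 ≤ τ) (hD : 0 ≤ D) (hΔ : 0 ≤ Δ)
    (hτ_le : τ ≤ (2 * γ - α + γ * β * τ) * s) (hτ_le' : τ ≤ (α - γ - γ / a) * s)
    (hle_τ : β * s ^ 2 ≤ (2 - γ * β * s) * τ)
    (hγc : 2 * γ * (α - γ) + γ / c - 1 + 2 * β * τ ≤ 0)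
    (hsmall : s * (β * (a * (α - γ) ^ 2 / γ + 3 * (α - γ) / 2)) ≤ 1 / 2)
    (hstrong : Δ + s ^ 2 / 2 * ‖x - y‖ ^ 2 ≤ ⟪q + s ^ 2 • x, x - y⟫_ℝ)
    {W : H} (hW : W = (γ * s) • (x - y) + v + β • q) :
    ⟪q + s ^ 2 • x, v⟫_ℝ - s ^ 2 * τ * ‖x‖ ^ 2
        + ⟪W, -(τ • (γ * s) • (x - y)) - ((α - γ) * s) • v - (q + s ^ 2 • x)⟫_ℝ
        + γ * s * D * ‖W‖ + ((α - γ) * s + τ) * (Δ + 1 / 2 * ‖W‖ ^ 2)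
        + β / 2 * ‖q + s ^ 2 • x‖ ^ 2 ≤
      γ * (2 * a + c * γ) / 2 * s * D ^ 2 - γ * β * s ^ 3 * τ / 2 * ‖y‖ ^ 2 := by
  have hpotential := potential_rate_le (v := v) hγ.le hβ hs hτ hΔ hτ_le hle_τ hstrong
  have hkinetic := inner_add_half_mul_norm_sq ((γ * s) • (x - y)) v (β • q) ((α - γ) * s) τ
  have hremainder := kinetic_remainder_le ha hc hγ (sub_nonneg.2 hγα) hs hτ hD hτ_le'
    ((γ * s) • (x - y)) v (β • q)
  rw [← hW] at hpotential hkinetic hremainder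
  have hu : s * (α - γ + 1 / (2 * c)) * ‖(γ * s) • (x - y)‖ ^ 2 ≤ γ * s ^ 3 / 2 * ‖x - y‖ ^ 2 := by
    have hcoef : 2 * γ * (α - γ) + γ / c ≤ 1 := by linarith [mul_nonneg hβ hτ]
    have hscaled := mul_le_mul_of_nonneg_right hcoef
      (by positivity : 0 ≤ γ * s ^ 3 / 2 * ‖x - y‖ ^ 2)
    rw [norm_smul, Real.norm_of_nonneg (mul_nonneg hγ.le hs), mul_pow]
    linear_combination hscaled
  have hq : s * (a * (α - γ) ^ 2 / γ + 3 * (α - γ) / 2) * ‖β • q‖ ^ 2 ≤ β / 2 * ‖q‖ ^ 2 := by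
    rw [norm_smul, Real.norm_of_nonneg hβ, mul_pow]
    linarith [mul_le_mul_of_nonneg_left hsmall (mul_nonneg hβ (sq_nonneg ‖q‖))]
  rw [inner_sub_right W _ (q + s ^ 2 • x)]
  linarith

end PointwiseEnergy

section AbsoluteContinuity

lemma absolutelyContinuousOnInterval_of_contDiffOn_Ici {F : Type*} [NormedAddCommGroup F]
    [NormedSpace ℝ F] {t₀ t T : ℝ} {f : ℝ → F} (hf : ContDiffOn ℝ 1 f (Ici t₀)) (ht : t₀ ≤ t)
    (hT : t ≤ T) : AbsolutelyContinuousOnInterval f t T := by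
  refine (hf.mono ?_).absolutelyContinuousOnInterval
  rw [uIcc_of_le hT]
  exact Icc_subset_Ici_self.trans (Ici_subset_Ici.2 ht)

lemma absolutelyContinuousOnInterval_congr {X : Type*} [PseudoMetricSpace X] {f g : ℝ → X}
    {a b : ℝ} (hf : AbsolutelyContinuousOnInterval f a b) (h : EqOn g f (uIcc a b)) :
    AbsolutelyContinuousOnInterval g a b := by
  refine Tendsto.congr' ?_ hf
  refine eventually_inf_principal.2 (Eventually.of_forall fun E hE => ?_)
  refine Finset.sum_congr rfl fun i hi => ?_
  rw [h (hE.1 i hi).1, h (hE.1 i hi).2]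

lemma absolutelyContinuousOnInterval_norm_sq {F : Type*} [SeminormedAddCommGroup F]
    {f : ℝ → F} {a b : ℝ} (hf : AbsolutelyContinuousOnInterval f a b) :
    AbsolutelyContinuousOnInterval (fun t => ‖f t‖ ^ 2) a b := by
  have h : AbsolutelyContinuousOnInterval (fun t => ‖f t‖) a b := by
    refine squeeze_zero (fun _ => Finset.sum_nonneg fun _ _ => dist_nonneg) (fun E => ?_) hf
    exact Finset.sum_le_sum fun i _ => dist_norm_norm_le _ _ |>.trans_eq (dist_eq_norm _ _).symm
  simpa only [sq] using h.fun_mul h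

lemma ae_differentiableAt_of_absolutelyContinuousOnInterval {f : ℝ → ℝ} {t₁ : ℝ}
    (hf : ∀ T, t₁ ≤ T → AbsolutelyContinuousOnInterval f t₁ T) :
    ∀ᵐ t, t₁ < t → DifferentiableAt ℝ f t := by
  have hnat : ∀ᵐ t, ∀ n : ℕ, t ∈ uIcc t₁ (t₁ + n) → DifferentiableAt ℝ f t :=
    ae_all_iff.2 fun n => (hf _ (le_add_of_nonneg_right n.cast_nonneg)).ae_differentiableAt
  filter_upwards [hnat] with t ht htt
  obtain ⟨n, hn⟩ := exists_nat_ge (t - t₁)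
  exact ht n (mem_uIcc_of_le htt.le (by linarith))

end AbsoluteContinuity

section Trajectory

variable {H : Type*} [NormedAddCommGroup H] [InnerProductSpace ℝ H] [CompleteSpace H]
  {Φ : H → EReal} {α β γ a c t₀ t T : ℝ} {lam eps : ℝ → ℝ} {x : ℝ → H}

namespace IsSolution

lemma continuousOn_velocity (hx : IsSolution Φ α β t₀ lam eps x) :
    ContinuousOn (dt t₀ x) (Ici t₀) := by
  intro t ht
  have ht' : t₀ ≤ t + 1 := le_add_of_le_of_nonneg ht zero_le_one
  have hcont := (hx.velocity_ac (t + 1) ht').continuousOn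
  rw [uIcc_of_le ht', ← Ici_inter_Iic] at hcont
  exact (hcont t ⟨ht, (lt_add_one t).le⟩).mono_of_mem_nhdsWithin
    (inter_mem_nhdsWithin _ (Iic_mem_nhds (lt_add_one t)))

lemma contDiffOn (hx : IsSolution Φ α β t₀ lam eps x) : ContDiffOn ℝ 1 x (Ici t₀) :=
  contDiffOn_one_Ici (fun t ht => (hx.differentiable t ht).hasDerivWithinAt)
    hx.continuousOn_velocity

lemma absolutelyContinuousOnInterval_velocity (hx : IsSolution Φ α β t₀ lam eps x) (ht : t₀ ≤ t)
    (hT : t ≤ T) : AbsolutelyContinuousOnInterval (dt t₀ x) t T := by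
  refine (hx.velocity_ac T (ht.trans hT)).mono ?_
  rw [uIcc_of_le hT, uIcc_of_le (ht.trans hT)]
  exact Icc_subset_Icc_left ht

end IsSolution

lemma IsProperConvexLsc.absolutelyContinuousOnInterval_yosida (hΦ : IsProperConvexLsc Φ)
    {k : ℝ → ℝ} (hk : ContDiffOn ℝ 1 k (Ici t₀)) (hk_pos : ∀ t, t₀ ≤ t → 0 < k t)
    (hx : ContDiffOn ℝ 1 x (Ici t₀)) (ht : t₀ ≤ t) (hT : t ≤ T) :
    AbsolutelyContinuousOnInterval (fun s => yosida Φ (k s) (x s)) t T := by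
  have hsub : Icc t T ⊆ Ici t₀ := Icc_subset_Ici_self.trans (Ici_subset_Ici.2 ht)
  obtain ⟨K₁, hK₁⟩ := (hk.mono hsub).exists_lipschitzOnWith one_ne_zero (convex_Icc _ _)
    isCompact_Icc
  obtain ⟨K₂, hK₂⟩ := (hx.mono hsub).exists_lipschitzOnWith one_ne_zero (convex_Icc _ _)
    isCompact_Icc
  obtain ⟨K, hK⟩ := hΦ.exists_lipschitzOnWith_yosida (fun s hs => hk_pos s (hsub hs)) hK₁ hK₂
  rw [← uIcc_of_le hT] at hK
  exact hK.absolutelyContinuousOnInterval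

namespace IsParameterPair

lemma absolutelyContinuousOnInterval_regMin (h : IsParameterPair t₀ lam eps)
    (hΦ : IsProperConvexLsc Φ) (ht : t₀ ≤ t) (hT : t ≤ T) :
    AbsolutelyContinuousOnInterval (fun s => regMin Φ (eps s) (lam s)) t T := by
  refine absolutelyContinuousOnInterval_congr
    ((absolutelyContinuousOnInterval_of_contDiffOn_Ici h.contDiffOn_one_div.neg ht hT).fun_smul
      (hΦ.absolutelyContinuousOnInterval_yosida h.contDiffOn_index (fun s hs => h.index_pos hs)
        (contDiffOn_const (c := (0 : H))) ht hT)) fun s hs => ?_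
  rw [uIcc_of_le hT] at hs
  exact hΦ.regMin_eq (h.eps_pos s (ht.trans hs.1)) (h.lam_pos s (ht.trans hs.1))

lemma contDiffOn_moreau_index (h : IsParameterPair t₀ lam eps) (hΦ : IsProperConvexLsc Φ) :
    ContDiffOn ℝ 1 (fun t => moreau Φ (1 / eps t + lam t) 0) (Ici t₀) :=
  contDiffOn_one_Ici (fun t ht => h.hasDerivWithinAt_moreau_index hΦ ht
    (h.eps_contDiffOn.differentiableOn one_ne_zero t ht).hasDerivWithinAt
    (h.lam_contDiffOn.differentiableOn one_ne_zero t ht).hasDerivWithinAt)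
  (((h.continuousOn_dt_eps.sub (h.continuousOn_dt_lam.mul
    (h.eps_contDiffOn.continuousOn.pow 2))).div_const 2).mul
    ((h.continuousOn_regMin hΦ).norm.pow 2))

end IsParameterPair

namespace IsSolution

lemma contDiffOn_moreau (hx : IsSolution Φ α β t₀ lam eps x) (h : IsParameterPair t₀ lam eps)
    (hΦ : IsProperConvexLsc Φ) : ContDiffOn ℝ 1 (fun t => moreau Φ (lam t) (x t)) (Ici t₀) := by
  have hq := hΦ.continuousOn_yosida (s := Ici t₀) h.lam_pos
    h.lam_contDiffOn.continuousOn hx.contDiffOn.continuousOn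
  exact contDiffOn_one_Ici (fun t ht => hΦ.hasDerivWithinAt_moreau (h.lam_pos t ht)
    (h.lam_contDiffOn.differentiableOn one_ne_zero t ht).hasDerivWithinAt
    (hx.differentiable t ht).hasDerivWithinAt)
    ((hq.inner hx.continuousOn_velocity).sub
      ((h.continuousOn_dt_lam.div_const 2).mul (hq.norm.pow 2)))

lemma continuousOn_gradient_phi (hx : IsSolution Φ α β t₀ lam eps x)
    (h : IsParameterPair t₀ lam eps) (hΦ : IsProperConvexLsc Φ) :
    ContinuousOn (fun t => gradient (phi Φ (eps t) (lam t)) (x t)) (Ici t₀) := by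
  have hx_cont := hx.contDiffOn.continuousOn
  exact ((hΦ.continuousOn_yosida h.lam_pos h.lam_contDiffOn.continuousOn hx_cont).add
    (h.eps_contDiffOn.continuousOn.smul hx_cont)).congr
    fun t ht => hΦ.gradient_phi (eps t) (h.lam_pos t ht) (x t)

end IsSolution

namespace IsParameterPair

lemma energy_eq (h : IsParameterPair t₀ lam eps) (hΦ : IsProperConvexLsc Φ) (ht : t₀ ≤ t) :
    energy Φ β γ t₀ lam eps x t =
      moreau Φ (lam t) (x t) + eps t * ‖x t‖ ^ 2 / 2 - moreau Φ (1 / eps t + lam t) 0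
      + 1 / 2 * ‖(γ * √(eps t)) • x t + dt t₀ x t + β • yosida Φ (lam t) (x t)
        - (γ * √(eps t)) • regMin Φ (eps t) (lam t)‖ ^ 2 := by
  rw [energy, hΦ.phi_regMin (h.eps_pos t ht) (h.lam_pos t ht),
    hΦ.gradient_moreau (h.lam_pos t ht), phi]
  congr 4
  module

lemma energy_nonneg (h : IsParameterPair t₀ lam eps) (hΦ : IsProperConvexLsc Φ) (ht : t₀ ≤ t) :
    0 ≤ energy Φ β γ t₀ lam eps x t :=
  add_nonneg (sub_nonneg.2 (hΦ.phi_regMin_le (h.eps_pos t ht) (h.lam_pos t ht) _)) (by positivity)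

end IsParameterPair

/-- The conditions on the Tikhonov parameter at time `t` under which the energy inequality holds
at `t`: the first three are those of the theorem, the last one holds at all large times because
`eps` vanishes at infinity. -/
structure IsAdmissibleTime (α β γ a c t₀ : ℝ) (eps : ℝ → ℝ) (t : ℝ) : Prop where
  dt_one_div_sqrt_le : dt t₀ (fun s => 1 / √(eps s)) t ≤
    min (2 * γ - α - γ * β * dt t₀ eps t / (2 * eps t)) (α - γ * ((a + 1) / a))
  mul_sub_mul_dt_nonpos : (2 * γ * (α - γ) + γ / c - 1) * eps t - β * dt t₀ eps t ≤ 0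
  sq_add_mul_dt_nonpos : 2 * β * eps t ^ 2 + (2 - γ * β * √(eps t)) * dt t₀ eps t ≤ 0
  sqrt_mul_le : √(eps t) * (β * (a * (α - γ) ^ 2 / γ + 3 * (α - γ) / 2)) ≤ 1 / 2

lemma eventually_isAdmissibleTime (heps : Tendsto eps atTop (𝓝 0))
    (h0 : ∀ᶠ t in atTop, dt t₀ (fun s => 1 / √(eps s)) t ≤
      min (2 * γ - α - γ * β * dt t₀ eps t / (2 * eps t)) (α - γ * ((a + 1) / a)))
    (h1 : ∀ᶠ t in atTop, (2 * γ * (α - γ) + γ / c - 1) * eps t - β * dt t₀ eps t ≤ 0)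
    (h2 : ∀ᶠ t in atTop, 2 * β * eps t ^ 2 + (2 - γ * β * √(eps t)) * dt t₀ eps t ≤ 0) :
    ∀ᶠ t in atTop, IsAdmissibleTime α β γ a c t₀ eps t := by
  have hsqrt := heps.sqrt.mul_const (β * (a * (α - γ) ^ 2 / γ + 3 * (α - γ) / 2))
  rw [Real.sqrt_zero, zero_mul] at hsqrt
  filter_upwards [h0, h1, h2, hsqrt.eventually_le_const one_half_pos] with t h0t h1t h2t hst
  exact ⟨h0t, h1t, h2t, hst⟩

namespace IsParameterPair

lemma mul_sqrt_le_two (h : IsParameterPair t₀ lam eps) (hβ : 0 ≤ β) (ht : t₀ ≤ t)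
    (hadm : IsAdmissibleTime α β γ a c t₀ eps t) : γ * β * √(eps t) ≤ 2 := by
  rcases hβ.eq_or_lt with rfl | hβ
  · simp
  by_contra! hlt
  have hsq := mul_pos (mul_pos two_pos hβ) (pow_pos (h.eps_pos t ht) 2)
  linarith [hadm.sq_add_mul_dt_nonpos,
    mul_nonneg_of_nonpos_of_nonpos (sub_neg.2 hlt).le (h.dt_eps_nonpos (t := t))]

lemma exists_nonneg_dt_eps_eq (h : IsParameterPair t₀ lam eps) (ht : t₀ ≤ t) :
    ∃ τ, 0 ≤ τ ∧ dt t₀ eps t = -(2 * √(eps t) ^ 2 * τ) ∧ dt t₀ eps t / (2 * eps t) = -τ := by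
  have he := h.eps_pos t ht
  refine ⟨-(dt t₀ eps t / (2 * eps t)), ?_, ?_, (neg_neg _).symm⟩
  · exact neg_nonneg.2 (div_nonpos_of_nonpos_of_nonneg h.dt_eps_nonpos (by positivity))
  · rw [Real.sq_sqrt he.le]
    field_simp

lemma rate_bounds (h : IsParameterPair t₀ lam eps) (ht : t₀ < t) {τ : ℝ}
    (hτ : dt t₀ eps t = -(2 * √(eps t) ^ 2 * τ)) (hmu : dt t₀ eps t / (2 * eps t) = -τ)
    (ha : a ≠ 0)
    (hadm : IsAdmissibleTime α β γ a c t₀ eps t) :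
    τ ≤ (2 * γ - α + γ * β * τ) * √(eps t) ∧ τ ≤ (α - γ - γ / a) * √(eps t) ∧
      2 * γ * (α - γ) + γ / c - 1 + 2 * β * τ ≤ 0 ∧
      β * √(eps t) ^ 2 ≤ (2 - γ * β * √(eps t)) * τ := by
  have he := h.eps_pos t ht.le
  have hs := Real.sqrt_pos.2 he
  obtain ⟨h0, h1, h2, -⟩ := hadm
  rw [h.dt_one_div_sqrt ht, mul_div_assoc (γ * β), hmu, neg_neg, le_min_iff, div_le_iff₀ hs,
    div_le_iff₀ hs, add_div, div_self ha, mul_add, mul_one, mul_one_div] at h0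
  rw [hτ, ← Real.sq_sqrt he.le, Real.sqrt_sq hs.le] at h1 h2
  have hsq : 0 < √(eps t) ^ 2 := by positivity
  refine ⟨by linarith [h0.1], by linarith [h0.2], le_of_mul_le_mul_left ?_ hsq,
    le_of_mul_le_mul_left ?_ (mul_pos two_pos hsq)⟩ <;> linarith

end IsParameterPair

namespace IsSolution

lemma absolutelyContinuousOnInterval_energy (hx : IsSolution Φ α β t₀ lam eps x)
    (h : IsParameterPair t₀ lam eps) (hΦ : IsProperConvexLsc Φ) (ht : t₀ ≤ t) (hT : t ≤ T) :
    AbsolutelyContinuousOnInterval (energy Φ β γ t₀ lam eps x) t T := by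
  have hρ : ContDiffOn ℝ 1 (fun s => γ * √(eps s)) (Ici t₀) :=
    contDiffOn_const.mul h.contDiffOn_sqrt
  have hpotential := absolutelyContinuousOnInterval_of_contDiffOn_Ici
    (((hx.contDiffOn_moreau h hΦ).add ((h.eps_contDiffOn.mul
      (hx.contDiffOn.norm_sq ℝ)).div_const 2)).sub (h.contDiffOn_moreau_index hΦ)) ht hT
  have hvelocity := hx.absolutelyContinuousOnInterval_velocity ht hT
  have hyosida := hΦ.absolutelyContinuousOnInterval_yosida h.lam_contDiffOn h.lam_pos
    hx.contDiffOn ht hT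
  have hkinetic := absolutelyContinuousOnInterval_norm_sq
    ((((absolutelyContinuousOnInterval_of_contDiffOn_Ici (hρ.smul hx.contDiffOn) ht hT).fun_add
      hvelocity).fun_add (hyosida.const_smul β)).fun_sub
    ((absolutelyContinuousOnInterval_of_contDiffOn_Ici hρ ht hT).fun_smul
      (h.absolutelyContinuousOnInterval_regMin hΦ ht hT)))
  refine absolutelyContinuousOnInterval_congr
    (hpotential.fun_add (hkinetic.const_mul (1 / 2))) fun s hs => ?_
  rw [uIcc_of_le hT] at hs
  rw [h.energy_eq hΦ (ht.trans hs.1)]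
  rfl

lemma hasDerivAt_potential (hx : IsSolution Φ α β t₀ lam eps x) (h : IsParameterPair t₀ lam eps)
    (hΦ : IsProperConvexLsc Φ) (ht : t₀ < t) :
    HasDerivAt (fun r => moreau Φ (lam r) (x r) + eps r * ‖x r‖ ^ 2 / 2
        - moreau Φ (1 / eps r + lam r) 0)
      (⟪yosida Φ (lam t) (x t) + eps t • x t, dt t₀ x t⟫_ℝ
        - dt t₀ lam t / 2 * ‖yosida Φ (lam t) (x t)‖ ^ 2 + dt t₀ eps t / 2 * ‖x t‖ ^ 2
        - (dt t₀ eps t - dt t₀ lam t * eps t ^ 2) / 2 * ‖regMin Φ (eps t) (lam t)‖ ^ 2) t := by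
  have hderiv_x := hasDerivAt_dt hx.differentiable ht
  have hderiv_moreau := hΦ.hasDerivWithinAt_moreau (h.lam_pos t ht.le)
    (h.hasDerivAt_lam ht).hasDerivWithinAt hderiv_x.hasDerivWithinAt (s := univ)
  have hderiv_index := h.hasDerivWithinAt_moreau_index hΦ ht.le (s := univ)
    (h.hasDerivAt_eps ht).hasDerivWithinAt (h.hasDerivAt_lam ht).hasDerivWithinAt
  rw [hasDerivWithinAt_univ] at hderiv_moreau hderiv_index
  refine ((hderiv_moreau.fun_add (((h.hasDerivAt_eps ht).fun_mul
    hderiv_x.norm_sq).div_const 2)).fun_sub hderiv_index).congr_deriv ?_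
  rw [inner_add_left, real_inner_smul_left]
  ring

lemma hasDerivAt_momentum (hx : IsSolution Φ α β t₀ lam eps x) (h : IsParameterPair t₀ lam eps)
    (hΦ : IsProperConvexLsc Φ) (ht : t₀ < t) {x'' w : H} (hx'' : HasDerivAt (dt t₀ x) x'' t)
    (hw : HasDerivAt (fun s => gradient (moreau Φ (lam s)) (x s)) w t)
    (heq : x'' + (α * √(eps t)) • dt t₀ x t + β • w + gradient (moreau Φ (lam t)) (x t)
      + eps t • x t = 0) :
    HasDerivAt (fun r => (γ * √(eps r)) • x r + dt t₀ x r + β • yosida Φ (lam r) (x r))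
      ((γ * (dt t₀ eps t / (2 * √(eps t)))) • x t - ((α - γ) * √(eps t)) • dt t₀ x t
        - (yosida Φ (lam t) (x t) + eps t • x t)) t := by
  have hρ := ((h.hasDerivAt_eps ht).sqrt (h.eps_pos t ht.le).ne').const_mul γ
  have hw' : HasDerivAt (fun s => yosida Φ (lam s) (x s)) w t := by
    refine hw.congr_of_eventuallyEq ?_
    filter_upwards [Ioi_mem_nhds ht] with r hr
    exact (hΦ.gradient_moreau (h.lam_pos r (le_of_lt hr)) _).symm
  refine (((hρ.fun_smul (hasDerivAt_dt hx.differentiable ht)).fun_add hx'').fun_add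
    (hw'.fun_const_smul β)).congr_deriv ?_
  rw [hΦ.gradient_moreau (h.lam_pos t ht.le)] at heq
  rw [← sub_eq_zero, ← heq]
  module

lemma deriv_energy_le_inner_add (hx : IsSolution Φ α β t₀ lam eps x)
    (h : IsParameterPair t₀ lam eps) (hΦ : IsProperConvexLsc Φ) (hγ : 0 ≤ γ) (ht : t₀ < t)
    (heq : ∃ x'' w : H, HasDerivAt (dt t₀ x) x'' t ∧
      HasDerivAt (fun s => gradient (moreau Φ (lam s)) (x s)) w t ∧
      x'' + (α * √(eps t)) • dt t₀ x t + β • w + gradient (moreau Φ (lam t)) (x t)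
        + eps t • x t = 0)
    (hE : DifferentiableAt ℝ (energy Φ β γ t₀ lam eps x) t) {y q W : H}
    (hy : y = regMin Φ (eps t) (lam t)) (hq : q = yosida Φ (lam t) (x t))
    (hW : W = (γ * √(eps t)) • (x t - y) + dt t₀ x t + β • q) :
    deriv (energy Φ β γ t₀ lam eps x) t ≤
      ⟪q + eps t • x t, dt t₀ x t⟫_ℝ - dt t₀ lam t / 2 * ‖q‖ ^ 2 + dt t₀ eps t / 2 * ‖x t‖ ^ 2
        - (dt t₀ eps t - dt t₀ lam t * eps t ^ 2) / 2 * ‖y‖ ^ 2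
        + ⟪W, (γ * (dt t₀ eps t / (2 * √(eps t)))) • (x t - y)
          - ((α - γ) * √(eps t)) • dt t₀ x t - (q + eps t • x t)⟫_ℝ
        + γ * √(eps t) * ((2 * dt t₀ lam t / lam t - dt t₀ eps t / eps t) * ‖y‖) * ‖W‖ := by
  obtain ⟨x'', w, hx'', hw, heq⟩ := heq
  have hpotential := hx.hasDerivAt_potential h hΦ ht
  have hmomentum := hx.hasDerivAt_momentum (γ := γ) h hΦ ht hx'' hw heq
  have hρ := ((h.hasDerivAt_eps ht).sqrt (h.eps_pos t ht.le).ne').const_mul γ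
  have hcont : Continuous fun L => γ * √(eps t) * (L * ‖y‖) * ‖W‖ := by fun_prop
  set D := 2 * dt t₀ lam t / lam t - dt t₀ eps t / eps t
  refine ge_of_tendsto (tendsto_const_nhds.add
    ((hcont.tendsto D).mono_left (nhdsWithin_le_nhds (s := Ioi D)))) ?_
  filter_upwards [self_mem_nhdsWithin] with L hL
  have hkinetic := hasDerivAt_le_of_half_norm_sq_of_norm_sub_le hmomentum hρ
    (fun r => mul_nonneg hγ (Real.sqrt_nonneg _)) (h.eventually_norm_regMin_sub_le hΦ ht hL)
    (hE.hasDerivAt.fun_sub hpotential) (by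
      filter_upwards [self_mem_nhdsWithin] with r hr
      rw [h.energy_eq hΦ (ht.le.trans hr), add_sub_cancel_left])
  have hW' : (γ * √(eps t)) • x t + dt t₀ x t + β • q - (γ * √(eps t)) • y = W := by
    rw [hW]
    module
  rw [← hy, ← hq, hW', sub_right_comm _ _ (_ • y), sub_right_comm _ _ (_ • y),
    ← smul_sub] at hkinetic
  linarith

lemma deriv_energy_add_le (hx : IsSolution Φ α β t₀ lam eps x) (h : IsParameterPair t₀ lam eps)
    (hΦ : IsProperConvexLsc Φ) (hβ : 0 ≤ β) (hγ : 0 < γ) (hγα : γ ≤ α) (ha : 0 < a) (hc : 0 < c)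
    (ht : t₀ < t) (hadm : IsAdmissibleTime α β γ a c t₀ eps t)
    (heq : ∃ x'' w : H, HasDerivAt (dt t₀ x) x'' t ∧
      HasDerivAt (fun s => gradient (moreau Φ (lam s)) (x s)) w t ∧
      x'' + (α * √(eps t)) • dt t₀ x t + β • w + gradient (moreau Φ (lam t)) (x t)
        + eps t • x t = 0)
    (hE : DifferentiableAt ℝ (energy Φ β γ t₀ lam eps x) t) :
    deriv (energy Φ β γ t₀ lam eps x) t + mu α γ t₀ eps t * energy Φ β γ t₀ lam eps x t
      + β / 2 * ‖gradient (phi Φ (eps t) (lam t)) (x t)‖ ^ 2 ≤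
    gfun β γ a c t₀ lam eps t * ‖regMin Φ (eps t) (lam t)‖ ^ 2 / 2 := by
  have he := h.eps_pos t ht.le
  have hl := h.lam_pos t ht.le
  have hs := Real.sqrt_pos.2 he
  obtain ⟨τ, hτ_nonneg, hτ, hmu⟩ := h.exists_nonneg_dt_eps_eq ht.le
  obtain ⟨hτ_le, hτ_le', hγc, hle_τ⟩ := h.rate_bounds ht hτ hmu ha.ne' hadm
  have hsmall := hadm.sqrt_mul_le
  have hrate : 0 ≤ 2 * dt t₀ lam t / lam t - dt t₀ eps t / eps t :=
    (abs_nonneg _).trans (h.abs_rate_le ht.le)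
  have hstrong := hΦ.phi_ge (eps t) hl (x t) (regMin Φ (eps t) (lam t))
  rw [← neg_sub (x t), inner_neg_right, norm_neg] at hstrong
  have hderiv := hx.deriv_energy_le_inner_add h hΦ hγ.le ht heq hE rfl rfl rfl
  rw [mu, gfun, energy, hΦ.gradient_phi (eps t) hl, hΦ.gradient_moreau hl]
  have hgap := sub_nonneg.2 (hΦ.phi_regMin_le he hl (x t))
  have hdl := mul_nonneg (h.dt_lam_nonneg (t := t)) (sq_nonneg ‖yosida Φ (lam t) (x t)‖)
  have hρ : γ * (dt t₀ eps t / (2 * √(eps t))) = -(τ * (γ * √(eps t))) := by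
    rw [hτ]
    field_simp
  set D := 2 * dt t₀ lam t / lam t - dt t₀ eps t / eps t
  rw [hρ, neg_smul, mul_smul τ] at hderiv
  rw [hmu]
  rw [hτ] at hderiv ⊢
  have hsq := (Real.sq_sqrt he.le).symm
  generalize √(eps t) = s at *
  generalize phi Φ (eps t) (lam t) = φ at *
  rw [hsq] at hderiv hstrong hgap ⊢
  have hmain := energy_rate_le (x := x t) (y := regMin Φ (s ^ 2) (lam t))
    (q := yosida Φ (lam t) (x t)) (v := dt t₀ x t) hβ hγ hγα ha hc hs.le hτ_nonneg
    (mul_nonneg hrate (norm_nonneg (regMin Φ (s ^ 2) (lam t)))) hgap hτ_le hτ_le' hle_τ hγc hsmall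
    (by linarith) rfl
  linarith

end IsSolution

end Trajectory

section Integration

variable {E μ b r : ℝ → ℝ} {t₁ t : ℝ}

lemma sub_le_integral_of_deriv_le (ht : t₁ ≤ t) (hE : AbsolutelyContinuousOnInterval E t₁ t)
    (hr : IntervalIntegrable r volume t₁ t) (h : ∀ᵐ s, t₁ < s → s ≤ t → deriv E s ≤ r s) :
    E t - E t₁ ≤ ∫ s in t₁..t, r s := by
  rw [← hE.integral_deriv_eq_sub]
  refine intervalIntegral.integral_mono_ae_restrict ht hE.intervalIntegrable_deriv hr ?_
  rw [← restrict_Ioc_eq_restrict_Icc]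
  exact (ae_restrict_iff' measurableSet_Ioc).2 (h.mono fun s hs hmem => hs hmem.1 hmem.2)

lemma integral_le_of_deriv_add_mul_add_le (ht : t₁ ≤ t)
    (hE : AbsolutelyContinuousOnInterval E t₁ t) (hE_nonneg : ∀ s ∈ Icc t₁ t, 0 ≤ E s)
    (hμ_nonneg : ∀ s ∈ Icc t₁ t, 0 ≤ μ s) (hb : IntervalIntegrable b volume t₁ t)
    (hr : IntervalIntegrable r volume t₁ t)
    (h : ∀ᵐ s, t₁ < s → deriv E s + μ s * E s + b s ≤ r s) :
    ∫ s in t₁..t, b s ≤ E t₁ + ∫ s in t₁..t, r s := by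
  have hgrowth := sub_le_integral_of_deriv_le (r := fun s => r s - b s) ht hE (hr.sub hb) (by
    filter_upwards [h] with s hs hlt hle
    have hmem : s ∈ Icc t₁ t := ⟨hlt.le, hle⟩
    linarith [hs hlt, mul_nonneg (hμ_nonneg s hmem) (hE_nonneg s hmem)])
  rw [intervalIntegral.integral_sub hr hb] at hgrowth
  linarith [hE_nonneg t (right_mem_Icc.2 ht)]

lemma hasDerivWithinAt_exp_integral (hμ : ContinuousOn μ (Ici t₁)) (ht : t₁ ≤ t) :
    HasDerivWithinAt (fun s => Real.exp (∫ r in t₁..s, μ r))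
      (Real.exp (∫ r in t₁..t, μ r) * μ t) (Ici t₁) t := by
  have hmem : t ∈ Icc t₁ (t + 1) := ⟨ht, (lt_add_one t).le⟩
  have : Fact (t ∈ Icc t₁ (t + 1)) := ⟨hmem⟩
  have hμ' : ContinuousOn μ (Icc t₁ (t + 1)) := hμ.mono Icc_subset_Ici_self
  have hint : IntervalIntegrable μ volume t₁ t :=
    (hμ.mono Icc_subset_Ici_self).intervalIntegrable_of_Icc ht
  refine (intervalIntegral.integral_hasDerivWithinAt_right (s := Icc t₁ (t + 1))
    (t := Icc t₁ (t + 1)) hint (hμ'.stronglyMeasurableAtFilter_nhdsWithin measurableSet_Icc t)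
    (hμ' t hmem)).exp.mono_of_mem_nhdsWithin ?_
  rw [← Ici_inter_Iic]
  exact inter_mem_nhdsWithin _ (Iic_mem_nhds (lt_add_one t))

lemma exp_integral_mul_sub_le_of_deriv_add_mul_le (ht : t₁ ≤ t)
    (hE : AbsolutelyContinuousOnInterval E t₁ t) (hμ : ContinuousOn μ (Ici t₁))
    (hr : IntervalIntegrable r volume t₁ t)
    (h : ∀ᵐ s, t₁ < s → DifferentiableAt ℝ E s ∧ deriv E s + μ s * E s ≤ r s) :
    Real.exp (∫ s in t₁..t, μ s) * E t - E t₁ ≤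
      ∫ s in t₁..t, Real.exp (∫ r in t₁..s, μ r) * r s := by
  have hderiv := fun s hs => hasDerivWithinAt_exp_integral (t := s) hμ hs
  have hcont : ContinuousOn (fun s => Real.exp (∫ r in t₁..s, μ r)) (Ici t₁) :=
    fun s hs => (hderiv s hs).continuousWithinAt
  have hgrowth := sub_le_integral_of_deriv_le ht
    ((absolutelyContinuousOnInterval_of_contDiffOn_Ici (contDiffOn_one_Ici hderiv (hcont.mul hμ))
      le_rfl ht).fun_mul hE) (hr.continuousOn_mul (hcont.mono (by
      rw [uIcc_of_le ht]; exact Icc_subset_Ici_self))) (by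
    filter_upwards [h] with s hs hlt _
    obtain ⟨hdiff, hle⟩ := hs hlt
    rw [(((hderiv s hlt.le).hasDerivAt (Ici_mem_nhds hlt)).fun_mul hdiff.hasDerivAt).deriv]
    exact (le_of_eq (by ring)).trans (mul_le_mul_of_nonneg_left hle (Real.exp_pos _).le))
  rwa [intervalIntegral.integral_same, Real.exp_zero, one_mul] at hgrowth

end Integration

section EnergyEstimates

variable {H : Type*} [NormedAddCommGroup H] [InnerProductSpace ℝ H] [CompleteSpace H]
  {Φ : H → EReal} {α β γ a c t₀ t₁ t : ℝ} {lam eps : ℝ → ℝ} {x : ℝ → H}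

namespace IsSolution

lemma ae_deriv_energy_add_le (hx : IsSolution Φ α β t₀ lam eps x) (h : IsParameterPair t₀ lam eps)
    (hΦ : IsProperConvexLsc Φ) (hβ : 0 ≤ β) (hγ : 0 < γ) (hγα : γ ≤ α) (ha : 0 < a) (hc : 0 < c)
    {z : H} (hz : z ∈ argminSet Φ) (ht₁ : t₀ < t₁)
    (hadm : ∀ t, t₁ ≤ t → IsAdmissibleTime α β γ a c t₀ eps t) :
    ∀ᵐ t, t₁ < t → DifferentiableAt ℝ (energy Φ β γ t₀ lam eps x) t ∧
      deriv (energy Φ β γ t₀ lam eps x) t + mu α γ t₀ eps t * energy Φ β γ t₀ lam eps x t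
        + β / 2 * ‖gradient (phi Φ (eps t) (lam t)) (x t)‖ ^ 2 ≤
      gfun β γ a c t₀ lam eps t * ‖z‖ ^ 2 / 2 := by
  have hdiff := ae_differentiableAt_of_absolutelyContinuousOnInterval fun T hT =>
    hx.absolutelyContinuousOnInterval_energy (β := β) (γ := γ) h hΦ ht₁.le hT
  filter_upwards [hdiff, hx.equation] with t hE heq hlt
  have ht : t₀ < t := ht₁.trans hlt
  have hg := h.gfun_nonneg hγ.le ha.le hc.le (h.mul_sqrt_le_two hβ ht.le (hadm t hlt.le))
  have hnorm := hΦ.norm_regMin_le (h.eps_pos t ht.le) (h.lam_pos t ht.le) hz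
  refine ⟨hE hlt, (hx.deriv_energy_add_le h hΦ hβ hγ hγα ha hc ht (hadm t hlt.le) (heq ht)
    (hE hlt)).trans ?_⟩
  gcongr

lemma mul_integral_norm_gradient_sq_le (hx : IsSolution Φ α β t₀ lam eps x)
    (h : IsParameterPair t₀ lam eps) (hΦ : IsProperConvexLsc Φ) (hγα : γ ≤ α) (ht₁ : t₀ ≤ t₁)
    {K : ℝ} (hle : ∀ᵐ t, t₁ < t →
      deriv (energy Φ β γ t₀ lam eps x) t + mu α γ t₀ eps t * energy Φ β γ t₀ lam eps x t
        + β / 2 * ‖gradient (phi Φ (eps t) (lam t)) (x t)‖ ^ 2 ≤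
      gfun β γ a c t₀ lam eps t * K / 2) (ht : t₁ ≤ t) :
    β * ∫ s in t₁..t, ‖gradient (phi Φ (eps s) (lam s)) (x s)‖ ^ 2 ≤
      2 * energy Φ β γ t₀ lam eps x t₁ + K * ∫ s in t₁..t, gfun β γ a c t₀ lam eps s := by
  have hsub : Icc t₁ t ⊆ Ici t₀ := Icc_subset_Ici_self.trans (Ici_subset_Ici.2 ht₁)
  have hdissipation := integral_le_of_deriv_add_mul_add_le ht
    (hx.absolutelyContinuousOnInterval_energy h hΦ ht₁ ht)
    (fun s hs => h.energy_nonneg hΦ (hsub hs)) (fun s hs => h.mu_nonneg hγα (hsub hs))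
    ((((hx.continuousOn_gradient_phi h hΦ).norm.pow 2).const_mul (β / 2)).mono hsub
      |>.intervalIntegrable_of_Icc ht)
    (((h.continuousOn_gfun.mul_const K).div_const 2).mono hsub |>.intervalIntegrable_of_Icc ht) hle
  simp only [Pi.pow_apply, intervalIntegral.integral_const_mul, intervalIntegral.integral_div,
    intervalIntegral.integral_mul_const] at hdissipation
  linarith

lemma energy_le (hx : IsSolution Φ α β t₀ lam eps x)
    (h : IsParameterPair t₀ lam eps) (hΦ : IsProperConvexLsc Φ) (hβ : 0 ≤ β) (ht₁ : t₀ ≤ t₁)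
    {K : ℝ} (hle : ∀ᵐ t, t₁ < t → DifferentiableAt ℝ (energy Φ β γ t₀ lam eps x) t ∧
      deriv (energy Φ β γ t₀ lam eps x) t + mu α γ t₀ eps t * energy Φ β γ t₀ lam eps x t
        + β / 2 * ‖gradient (phi Φ (eps t) (lam t)) (x t)‖ ^ 2 ≤
      gfun β γ a c t₀ lam eps t * K / 2) (ht : t₁ ≤ t) :
    energy Φ β γ t₀ lam eps x t ≤ K / (2 * Gam α γ t₀ eps t₁ t)
        * (∫ s in t₁..t, Gam α γ t₀ eps t₁ s * gfun β γ a c t₀ lam eps s)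
      + Gam α γ t₀ eps t₁ t₁ * energy Φ β γ t₀ lam eps x t₁ / Gam α γ t₀ eps t₁ t := by
  have hsub : Ici t₁ ⊆ Ici t₀ := Ici_subset_Ici.2 ht₁
  have hgronwall := exp_integral_mul_sub_le_of_deriv_add_mul_le ht
    (hx.absolutelyContinuousOnInterval_energy (β := β) (γ := γ) h hΦ ht₁ ht)
    ((h.continuousOn_mu (α := α) (γ := γ)).mono hsub)
    (((h.continuousOn_gfun (β := β) (γ := γ) (a := a) (c := c)).const_mul (K / 2)).mono
      (Icc_subset_Ici_self.trans hsub) |>.intervalIntegrable_of_Icc ht) (by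
      filter_upwards [hle] with s hs hlt
      obtain ⟨hdiff, hs⟩ := hs hlt
      refine ⟨hdiff, ?_⟩
      have hgrad : 0 ≤ β / 2 * ‖gradient (phi Φ (eps s) (lam s)) (x s)‖ ^ 2 := by positivity
      linarith)
  simp only [← Gam.eq_1, mul_left_comm _ (K / 2), intervalIntegral.integral_const_mul]
    at hgronwall
  have hΓ₁ : Gam α γ t₀ eps t₁ t₁ = 1 := by
    rw [Gam, intervalIntegral.integral_same, Real.exp_zero]
  have hΓ : 0 < Gam α γ t₀ eps t₁ t := Real.exp_pos _
  rw [hΓ₁, one_mul, div_mul_eq_mul_div, mul_comm (2 : ℝ), ← div_div, div_right_comm, ← add_div,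
    le_div_iff₀ hΓ]
  linarith

end IsSolution

end EnergyEstimates

end TikhonovMoreau

end

theorem mainTheorem1_general {H : Type*} [NormedAddCommGroup H] [InnerProductSpace ℝ H]
    [CompleteSpace H] (Φ : H → EReal) (hΦ : TikhonovMoreau.IsProperConvexLsc Φ)
    (hargmin : (TikhonovMoreau.argminSet Φ).Nonempty) (α β γ a c t₀ : ℝ) (hβ : 0 ≤ β)
    (hγ : 0 < γ) (hγα : γ ≤ α) (ha : 0 < a) (hc : 0 < c) (lam eps : ℝ → ℝ)
    (h : TikhonovMoreau.IsParameterPair t₀ lam eps) (heps_lim : Tendsto eps atTop (𝓝 0))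
    (h0 : ∀ᶠ t in atTop, TikhonovMoreau.dt t₀ (fun s => 1 / √(eps s)) t ≤
      min (2 * γ - α - γ * β * TikhonovMoreau.dt t₀ eps t / (2 * eps t))
        (α - γ * ((a + 1) / a)))
    (h1 : ∀ᶠ t in atTop,
      (2 * γ * (α - γ) + γ / c - 1) * eps t - β * TikhonovMoreau.dt t₀ eps t ≤ 0)
    (h2 : ∀ᶠ t in atTop,
      2 * β * eps t ^ 2 + (2 - γ * β * √(eps t)) * TikhonovMoreau.dt t₀ eps t ≤ 0)
    (x : ℝ → H) (hx : TikhonovMoreau.IsSolution Φ α β t₀ lam eps x) :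
    let E : ℝ → ℝ := TikhonovMoreau.energy Φ β γ t₀ lam eps x
    let μ : ℝ → ℝ := TikhonovMoreau.mu α γ t₀ eps
    let g : ℝ → ℝ := TikhonovMoreau.gfun β γ a c t₀ lam eps
    let G : ℝ → H := fun t => gradient (TikhonovMoreau.phi Φ (eps t) (lam t)) (x t)
    let xs : H := TikhonovMoreau.minNormSol Φ
    ∃ t₁, t₀ ≤ t₁ ∧
      (∀ T, t₁ ≤ T → AbsolutelyContinuousOnInterval E t₁ T) ∧
      (∀ᵐ t, t₁ < t → DifferentiableAt ℝ E t ∧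
        deriv E t + μ t * E t + β / 2 * ‖G t‖ ^ 2 ≤ g t * ‖xs‖ ^ 2 / 2) ∧
      ∀ t, t₁ ≤ t →
        IntervalIntegrable (fun s => ‖G s‖ ^ 2) volume t₁ t ∧
        β * ∫ s in t₁..t, ‖G s‖ ^ 2 ≤ 2 * E t₁ + ‖xs‖ ^ 2 * ∫ s in t₁..t, g s ∧
        E t ≤ ‖xs‖ ^ 2 / (2 * TikhonovMoreau.Gam α γ t₀ eps t₁ t)
              * (∫ s in t₁..t, TikhonovMoreau.Gam α γ t₀ eps t₁ s * g s)
            + TikhonovMoreau.Gam α γ t₀ eps t₁ t₁ * E t₁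
              / TikhonovMoreau.Gam α γ t₀ eps t₁ t := by
  intro E μ g G xs
  obtain ⟨t₁, ht₁⟩ := eventually_atTop.1 ((eventually_gt_atTop t₀).and
    (TikhonovMoreau.eventually_isAdmissibleTime heps_lim h0 h1 h2))
  have ht₀₁ : t₀ < t₁ := (ht₁ t₁ le_rfl).1
  have hrate := hx.ae_deriv_energy_add_le h hΦ hβ hγ hγα ha hc
    (hΦ.minNormSol_mem hargmin) ht₀₁ fun t ht => (ht₁ t ht).2
  have hgrad : ContinuousOn (fun t => ‖G t‖ ^ 2) (Ici t₀) :=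
    (hx.continuousOn_gradient_phi h hΦ).norm.pow 2
  refine ⟨t₁, ht₀₁.le, fun T hT => hx.absolutelyContinuousOnInterval_energy h hΦ ht₀₁.le hT,
    hrate, fun t ht => ⟨?_, ?_, hx.energy_le h hΦ hβ ht₀₁.le hrate ht⟩⟩
  · exact (hgrad.mono (Icc_subset_Ici_self.trans (Ici_subset_Ici.2 ht₀₁.le)))
      |>.intervalIntegrable_of_Icc ht
  · exact hx.mul_integral_norm_gradient_sq_le h hΦ hγα ht₀₁.le
      (hrate.mono fun s hs hlt => (hs hlt).2) ht

theorem mainTheorem1 {H : Type*} [NormedAddCommGroup H] [InnerProductSpace ℝ H] [CompleteSpace H]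
    (Φ : H → EReal) (hΦ : TikhonovMoreau.IsProperConvexLsc Φ)
    (hargmin : (TikhonovMoreau.argminSet Φ).Nonempty)
    (α β γ a c t₀ : ℝ) (hα : 0 < α) (hβ : 0 < β) (ht₀ : 0 < t₀)
    (hγ : α / 2 ≤ γ) (hγα : γ < α) (ha : 0 < a) (hc : 0 < c)
    (lam eps : ℝ → ℝ)
    (hlam_pos : ∀ t, t₀ ≤ t → 0 < lam t) (hlam_C1 : ContDiffOn ℝ 1 lam (Ici t₀))
    (hlam_mono : MonotoneOn lam (Ici t₀))
    (heps_pos : ∀ t, t₀ ≤ t → 0 < eps t) (heps_C1 : ContDiffOn ℝ 1 eps (Ici t₀))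
    (heps_anti : AntitoneOn eps (Ici t₀)) (heps_lim : Tendsto eps atTop (𝓝 0))
    (hlam_eps : Tendsto (fun t => lam t * eps t) atTop (𝓝 0))
    (h0 : ∀ᶠ t in atTop, TikhonovMoreau.dt t₀ (fun s => 1 / √(eps s)) t ≤
      min (2 * γ - α - γ * β * TikhonovMoreau.dt t₀ eps t / (2 * eps t))
        (α - γ * ((a + 1) / a)))
    (h1 : ∀ᶠ t in atTop,
      (2 * γ * (α - γ) + γ / c - 1) * eps t - β * TikhonovMoreau.dt t₀ eps t ≤ 0)
    (h2 : ∀ᶠ t in atTop,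
      2 * β * eps t ^ 2 + (2 - γ * β * √(eps t)) * TikhonovMoreau.dt t₀ eps t ≤ 0)
    (h3 : ∀ᶠ t in atTop,
      (γ / a + 2 * (α - γ)) * β ^ 2 * √(eps t)
        - 3 * β ^ 2 * TikhonovMoreau.dt t₀ eps t / (2 * eps t)
        - TikhonovMoreau.dt t₀ lam t ≤ β)
    (x : ℝ → H) (hx : TikhonovMoreau.IsSolution Φ α β t₀ lam eps x) :
    let E : ℝ → ℝ := TikhonovMoreau.energy Φ β γ t₀ lam eps x
    let μ : ℝ → ℝ := TikhonovMoreau.mu α γ t₀ eps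
    let g : ℝ → ℝ := TikhonovMoreau.gfun β γ a c t₀ lam eps
    let G : ℝ → H := fun t => gradient (TikhonovMoreau.phi Φ (eps t) (lam t)) (x t)
    let xs : H := TikhonovMoreau.minNormSol Φ
    ∃ t₁, t₀ ≤ t₁ ∧
      (∀ T, t₁ ≤ T → AbsolutelyContinuousOnInterval E t₁ T) ∧
      (∀ᵐ t, t₁ < t → DifferentiableAt ℝ E t ∧
        deriv E t + μ t * E t + β / 2 * ‖G t‖ ^ 2 ≤ g t * ‖xs‖ ^ 2 / 2) ∧
      ∀ t, t₁ ≤ t →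
        IntervalIntegrable (fun s => ‖G s‖ ^ 2) volume t₁ t ∧
        β * ∫ s in t₁..t, ‖G s‖ ^ 2 ≤ 2 * E t₁ + ‖xs‖ ^ 2 * ∫ s in t₁..t, g s ∧
        E t ≤ ‖xs‖ ^ 2 / (2 * TikhonovMoreau.Gam α γ t₀ eps t₁ t)
              * (∫ s in t₁..t, TikhonovMoreau.Gam α γ t₀ eps t₁ s * g s)
            + TikhonovMoreau.Gam α γ t₀ eps t₁ t₁ * E t₁
              / TikhonovMoreau.Gam α γ t₀ eps t₁ t := by
  exact mainTheorem1_general Φ hΦ hargmin α β γ a c t₀ hβ.le ((half_pos hα).trans_le hγ) hγα.le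
    ha hc lam eps ⟨hlam_pos, hlam_C1, hlam_mono, heps_pos, heps_C1, heps_anti⟩ heps_lim h0 h1 h2
    x hx
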